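/- **Definitions.** Let $X$ be a complex manifold of dimension $n$; currents on $X$ are continuous linear functionals on the smooth complex-valued forms with compact support. For $m\ge 1$ let $[1/s^m]$ be the principal value current in $\mathbb C$, so that $[1/s^m]=\frac{(-1)^{m-1}}{(m-1)!}\frac{\partial^{m-1}}{\partial s^{m-1}}\frac1s$ in the sense of distributions, where $1/s$ is locally integrable. An *elementary current* in an open set $\mathcal U'\subset\mathbb C^N$ with coordinates $t_1,\dots,t_N$ is, after a permutation of the coordinates, a current of the form $$\tau=\alpha\wedge\Big[\frac1{t_1^{m_1}}\Big]\cdots\Big[\frac1{t_k^{m_k}}\Big]\,\bar\partial\Big[\frac1{t_{k+1}^{m_{k+1}}}\Big]\wedge\cdots\wedge\bar\partial\Big[\frac1{t_r^{m_r}}\Big],$$ where $0\le k\le r\le N$, $m_j\ge1$, and $\alpha$ is a smooth form with compact support in $\mathcal U'$ (the product is the tensor product of the one-variable currents, multiplied by $\alpha$). A current $\mu$ on $X$ is *pseudomeromorphic* if every point of $X$ has a neighborhood in which $\mu$ is a finite sum of direct images $f_*\tau$, where $\tau$ is an elementary current in some open $\mathcal U'\subset\mathbb C^N$, $f$ is a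 holomorphic map from $\mathcal U'$ to $X$, and $(f_*\tau).\xi=\tau.(f^*\xi)$ ($N$, $\mathcal U'$, $f$, $\tau$ may vary with the term). A compact set $V\subset X$ is a *compact quasianalytic set of dimension $\le d$* if there are a (not necessarily connected) complex manifold $Y$, a holomorphic map $f\colon Y\to X$ and a compact set $K\subset Y$ such that $V=f(K)$ and $\operatorname{rank}_y f\le d$ for all $y\in K$. (For $d=-1$ this means $V=\emptyset$.) **Theorem.** Let $\mu$ be a pseudomeromorphic current with compact support on a complex manifold $X$ of dimension $n$. Then there is a compact quasianalytic set $V\subset X$ of dimension $\le n-1$ such that $\mu$ is smooth in $X\setminus V$, i.e. every point of $X\setminus V$ has a neighborhood in which $\mu$ is given by integration against a smooth form. -/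

import Mathlib

open scoped Manifold ContDiff Topology

noncomputable section

namespace PMCurrents

/-- The space `ℂⁿ`. -/
abbrev Cn (n : ℕ) : Type := EuclideanSpace ℂ (Fin n)

/-- Complex-valued `ℝ`-multilinear alternating `r`-forms on `ℂⁿ` (they comprise all
bidegrees `(a, b)` with `a + b = r`). -/
abbrev Alt (n r : ℕ) : Type := Cn n [⋀^Fin r]→L[ℝ] ℂ

/-! ### Exterior algebra -/

/-- The multilinear map `(v₁, …, v_{p+q}) ↦ θ(v₁, …, v_p) η(v_{p+1}, …, v_{p+q})`. -/
def mulForms {n p q : ℕ} (θ : Alt n p) (η : Alt n q) :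
    ContinuousMultilinearMap ℝ (fun _ : Fin (p + q) => Cn n) ℂ where
  toFun v := θ (fun i => v (Fin.castAdd q i)) * η (fun i => v (Fin.natAdd p i))
  map_update_add' := by
    intro _ v i x y
    refine Fin.addCases (fun j => ?_) (fun j => ?_) i
    · have h1 : ∀ z : Cn n, (fun k => Function.update v (Fin.castAdd q j) z (Fin.castAdd q k)) =
          Function.update (fun k => v (Fin.castAdd q k)) j z := fun z =>
        Function.update_comp_eq_of_injective v (Fin.castAdd_injective p q) j z
      have h2 : ∀ z : Cn n, (fun k => Function.update v (Fin.castAdd q j) z (Fin.natAdd p k)) =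
          fun k => v (Fin.natAdd p k) := fun z => by
        funext k
        exact Function.update_of_ne (by simp [Fin.ext_iff]; omega) _ _
      simp only [h1, h2, ContinuousAlternatingMap.map_update_add, add_mul]
    · have h1 : ∀ z : Cn n, (fun k => Function.update v (Fin.natAdd p j) z (Fin.natAdd p k)) =
          Function.update (fun k => v (Fin.natAdd p k)) j z := fun z =>
        Function.update_comp_eq_of_injective v (Fin.natAdd_injective q p) j z
      have h2 : ∀ z : Cn n, (fun k => Function.update v (Fin.natAdd p j) z (Fin.castAdd q k)) =
          fun k => v (Fin.castAdd q k) := fun z => by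
        funext k
        exact Function.update_of_ne (by simp [Fin.ext_iff]; omega) _ _
      simp only [h1, h2, ContinuousAlternatingMap.map_update_add, mul_add]
  map_update_smul' := by
    intro _ v i c x
    refine Fin.addCases (fun j => ?_) (fun j => ?_) i
    · have h1 : ∀ z : Cn n, (fun k => Function.update v (Fin.castAdd q j) z (Fin.castAdd q k)) =
          Function.update (fun k => v (Fin.castAdd q k)) j z := fun z =>
        Function.update_comp_eq_of_injective v (Fin.castAdd_injective p q) j z
      have h2 : ∀ z : Cn n, (fun k => Function.update v (Fin.castAdd q j) z (Fin.natAdd p k)) =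
          fun k => v (Fin.natAdd p k) := fun z => by
        funext k
        exact Function.update_of_ne (by simp [Fin.ext_iff]; omega) _ _
      simp only [h1, h2, ContinuousAlternatingMap.map_update_smul, smul_mul_assoc]
    · have h1 : ∀ z : Cn n, (fun k => Function.update v (Fin.natAdd p j) z (Fin.natAdd p k)) =
          Function.update (fun k => v (Fin.natAdd p k)) j z := fun z =>
        Function.update_comp_eq_of_injective v (Fin.natAdd_injective q p) j z
      have h2 : ∀ z : Cn n, (fun k => Function.update v (Fin.natAdd p j) z (Fin.castAdd q k)) =
          fun k => v (Fin.castAdd q k) := fun z => by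
        funext k
        exact Function.update_of_ne (by simp [Fin.ext_iff]; omega) _ _
      simp only [h1, h2, ContinuousAlternatingMap.map_update_smul, mul_smul_comm]
  cont := by
    have h1 : Continuous fun v : Fin (p + q) → Cn n => fun i => v (Fin.castAdd q i) := by fun_prop
    have h2 : Continuous fun v : Fin (p + q) → Cn n => fun i => v (Fin.natAdd p i) := by fun_prop
    exact (θ.cont.comp h1).mul (η.cont.comp h2)

/-- The exterior product `θ ∧ η`, normalized so that `ℓ₁ ∧ ⋯ ∧ ℓ_k = det (ℓ_i(v_j))` for
`1`-forms. -/
def wedge {n p q : ℕ} (θ : Alt n p) (η : Alt n q) : Alt n (p + q) :=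
  (1 / ((p.factorial : ℂ) * (q.factorial : ℂ))) •
    ContinuousMultilinearMap.alternatization (mulForms θ η)

/-- The exterior product `ℓ₁ ∧ ⋯ ∧ ℓ_q` of `1`-forms, `(v_j) ↦ det (ℓ_i(v_j))`. -/
def wedgeOneForms {n q : ℕ} (l : Fin q → (Cn n →L[ℝ] ℂ)) : Alt n q :=
  ContinuousMultilinearMap.alternatization
    ((ContinuousMultilinearMap.mkPiAlgebra ℝ (Fin q) ℂ).compContinuousLinearMap l)

/-- The `1`-form `d t̄_j` on `ℂⁿ`. -/
def dConj {n : ℕ} (j : Fin n) : Cn n →L[ℝ] ℂ :=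
  (Complex.conjCLE : ℂ →L[ℝ] ℂ).comp
    ((EuclideanSpace.proj j : Cn n →L[ℂ] ℂ).restrictScalars ℝ)

/-- The oriented real frame `e₁, i e₁, e₂, i e₂, …, e_n, i e_n` of `ℂⁿ`. -/
def realFrame (n : ℕ) (k : Fin (2 * n)) : Cn n :=
  EuclideanSpace.single (⟨k.1 / 2, by omega⟩ : Fin n) (if k.1 % 2 = 0 then 1 else Complex.I)

/-- The coefficient of a form of degree `2n` with respect to `dx₁ ∧ dy₁ ∧ ⋯ ∧ dx_n ∧ dy_n`;
it is `0` for forms of any other degree. -/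
def topCoeff {n k : ℕ} (θ : Alt n k) : ℂ :=
  if h : k = 2 * n then θ (fun i => realFrame n (Fin.cast h i)) else 0

/-! ### Forms and currents on a complex manifold -/

section Manifold

variable {n : ℕ} {X : Type*} [TopologicalSpace X] [ChartedSpace (Cn n) X]

/-- The pullback `f^* ξ` under `f : ℂᴺ → X` of an `r`-form `ξ` on `X`. -/
def pullback {N r : ℕ} (f : Cn N → X) (ξ : X → Alt n r) (t : Cn N) : Alt N r :=
  (ξ (f t)).compContinuousLinearMap
    ((mfderiv 𝓘(ℂ, Cn N) 𝓘(ℂ, Cn n) f t : Cn N →L[ℂ] Cn n).restrictScalars ℝ)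

variable (n X) in
/-- The space of test forms of degree `r` on `X`: complex-valued smooth `r`-forms with compact
support.  The value `ξ x` is a form on the tangent space `T_x X`, which in Mathlib is the model
space `ℂⁿ`, identified by means of the preferred chart at `x`; smoothness is smoothness of
the coordinate expressions. -/
def TestForm (r : ℕ) : Submodule ℂ (X → Alt n r) where
  carrier := {ξ | HasCompactSupport ξ ∧
    ∀ x : X, ContDiffOn ℝ ∞ (pullback (chartAt (Cn n) x).symm ξ) (chartAt (Cn n) x).target}
  add_mem' := by
    rintro ξ η ⟨h1, h2⟩ ⟨h3, h4⟩
    exact ⟨h1.add h3, fun x => (h2 x).add (h4 x)⟩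
  zero_mem' := by
    refine ⟨HasCompactSupport.zero, fun x => ?_⟩
    exact contDiffOn_const (c := (0 : Alt n r))
  smul_mem' := by
    rintro c ξ ⟨h1, h2⟩
    refine ⟨h1.smul_left (f := fun _ => c), fun x => ?_⟩
    exact (h2 x).const_smul c

variable (n X) in
/-- A current on `X`: a linear functional on the test forms (of all degrees) which is continuous,
i.e. on the test forms supported in a compact subset `K` of a coordinate neighborhood it is
bounded by a constant times a `C^k`-norm. -/
structure Current where
  toFun : ∀ r : ℕ, TestForm n X r →ₗ[ℂ] ℂ
  continuous' : ∀ (r : ℕ) (x : X) (K : Set X), IsCompact K → K ⊆ (chartAt (Cn n) x).source →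
    ∃ (C : ℝ) (k : ℕ), ∀ ξ : TestForm n X r, tsupport ξ.1 ⊆ K → ∀ B : ℝ,
      (∀ i ≤ k, ∀ z ∈ chartAt (Cn n) x '' K,
        ‖iteratedFDeriv ℝ i (pullback (chartAt (Cn n) x).symm ξ.1) z‖ ≤ B) →
      ‖toFun r ξ‖ ≤ C * B

/-- The support of a current. -/
def Current.support (μ : Current n X) : Set X :=
  {x | ∀ U : Set X, IsOpen U → x ∈ U →
    ∃ (r : ℕ) (ξ : TestForm n X r), tsupport ξ.1 ⊆ U ∧ μ.toFun r ξ ≠ 0}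

/-- `μ` is smooth in the open set `W`: near every point of `W` it is integration against a
smooth form `b` (with component `b k` of degree `k`), `μ.ξ = ∫ b ∧ ξ`. -/
def Current.SmoothOn (μ : Current n X) (W : Set X) : Prop :=
  ∀ p ∈ W, ∃ U : Set X, IsOpen U ∧ p ∈ U ∧ U ⊆ W ∩ (chartAt (Cn n) p).source ∧
    ∃ b : ∀ k : ℕ, Cn n → Alt n k,
      (∀ k, ContDiffOn ℝ ∞ (b k) (chartAt (Cn n) p '' U)) ∧
      ∀ k r : ℕ, k + r = 2 * n → ∀ ξ : TestForm n X r, tsupport ξ.1 ⊆ U →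
        μ.toFun r ξ = ∫ z in (chartAt (Cn n) p).target,
          topCoeff (wedge (b k z) (pullback (chartAt (Cn n) p).symm ξ.1 z))

end Manifold

/-! ### Elementary currents -/

/-- The operator `∂/∂t_j = (∂/∂x_j - i ∂/∂y_j)/2`. -/
def dHol {N : ℕ} (j : Fin N) (g : Cn N → ℂ) (t : Cn N) : ℂ :=
  (1 / 2) * (fderiv ℝ g t (EuclideanSpace.single j 1) -
    Complex.I * fderiv ℝ g t (EuclideanSpace.single j Complex.I))

/-- The operator `∂/∂t̄_j = (∂/∂x_j + i ∂/∂y_j)/2`. -/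
def dBar {N : ℕ} (j : Fin N) (g : Cn N → ℂ) (t : Cn N) : ℂ :=
  (1 / 2) * (fderiv ℝ g t (EuclideanSpace.single j 1) +
    Complex.I * fderiv ℝ g t (EuclideanSpace.single j Complex.I))

/-- An elementary current in an open set `dom ⊆ ℂᴺ`:
`τ = α ∧ ∏_{j ∈ pv} [1 / t_j^{ord j + 1}] ∧ ⋀_{j ∈ res} ∂̄[1 / t_j^{ord j + 1}]`,
where `α` is a smooth form (of degree `deg`) with compact support in `dom`. -/
structure ElementaryCurrent (N : ℕ) where
  dom : Set (Cn N)
  isOpen_dom : IsOpen dom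
  pv : Finset (Fin N)
  res : Finset (Fin N)
  disjoint_pv_res : Disjoint pv res
  ord : Fin N → ℕ
  deg : ℕ
  α : Cn N → Alt N deg
  smooth_α : ContDiff ℝ ∞ α
  compact_α : HasCompactSupport α
  tsupport_α : tsupport α ⊆ dom

namespace ElementaryCurrent

variable {N : ℕ} (τ : ElementaryCurrent N)

/-- The derivatives in the variable `t_j` that act on test functions.  In one variable,
`[1/s^{m+1}] = (-1)^m/m! (∂/∂s)^m [1/s]` with `1/s` locally integrable, hence
`⟨[1/s^{m+1}], g⟩ = 1/m! ∫ (1/s) (∂/∂s)^m g`, and `∂̄[1/s^{m+1}] = (∂/∂s̄)[1/s^{m+1}] ds̄`, where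
`⟨(∂/∂s̄)[1/s^{m+1}], g⟩ = -1/m! ∫ (1/s) (∂/∂s̄)(∂/∂s)^m g`. -/
def transposed (j : Fin N) (g : Cn N → ℂ) : Cn N → ℂ :=
  if j ∈ τ.pv then (dHol j)^[τ.ord j] g
  else if j ∈ τ.res then fun t => -(dBar j ((dHol j)^[τ.ord j] g) t)
  else g

/-- The tensor product of the one-variable distributions `[1/t_j^{ord j + 1}]`, `j ∈ pv`, and
`(∂/∂t̄_j)[1/t_j^{ord j + 1}]`, `j ∈ res` (and `1` in the remaining variables), applied to a test
function `g`. -/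
def scalarPart (g : Cn N → ℂ) : ℂ :=
  ∫ t : Cn N, (∏ j ∈ τ.pv ∪ τ.res, 1 / (((τ.ord j).factorial : ℂ) * t j)) *
    (List.finRange N).foldr τ.transposed g t

/-- The form `⋀_{j ∈ res} d t̄_j`, the indices in increasing order. -/
def dConjRes : Alt N τ.res.card :=
  wedgeOneForms fun i => dConj (τ.res.orderEmbOfFin rfl i)

/-- The action `τ.η` on a smooth form `η` of degree `r` on `dom` (compactness of the support of
`η` is not needed as `α` has compact support). -/
def eval {r : ℕ} (η : Cn N → Alt N r) : ℂ :=
  τ.scalarPart fun t => topCoeff (wedge (wedge (τ.α t) τ.dConjRes) (η t))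

end ElementaryCurrent

section Manifold

variable {n : ℕ} {X : Type*} [TopologicalSpace X] [ChartedSpace (Cn n) X]

variable (n X) in
/-- An elementary current `τ` together with a holomorphic map `f` from its domain to `X`
(the values of `f` outside the domain are irrelevant). -/
structure PushedElementary where
  N : ℕ
  τ : ElementaryCurrent N
  f : Cn N → X
  holo : ContMDiffOn 𝓘(ℂ, Cn N) 𝓘(ℂ, Cn n) ω f τ.dom

/-- The direct image `f_* τ`, given by `(f_* τ).ξ = τ.(f^* ξ)`. -/
def PushedElementary.eval (P : PushedElementary n X) {r : ℕ} (ξ : TestForm n X r) : ℂ :=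
  P.τ.eval (pullback P.f ξ.1)

/-- A current is pseudomeromorphic if in a neighborhood of every point it is a finite sum of
direct images of elementary currents under holomorphic maps. -/
def Current.IsPseudomeromorphic (μ : Current n X) : Prop :=
  ∀ x : X, ∃ U : Set X, IsOpen U ∧ x ∈ U ∧ ∃ (s : ℕ) (P : Fin s → PushedElementary n X),
    ∀ (r : ℕ) (ξ : TestForm n X r), tsupport ξ.1 ⊆ U → μ.toFun r ξ = ∑ l, (P l).eval ξ

/-- `V ⊆ X` is a compact quasianalytic set of dimension at most `d`: `V = f(K)` where
`f : Y → X` is a holomorphic map from a (Hausdorff, second countable, not necessarily connected)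
complex manifold, `K ⊆ Y` is compact, and `rank_y f ≤ d` for all `y ∈ K`.  That `Y` has the same
dimension `m` everywhere is no restriction: `K` meets only finitely many components of `Y`, and
multiplying a component by some `ℂᵏ` (composing `f` with the projection) changes neither the image
nor the rank. -/
def IsCompactQuasianalytic (n : ℕ) {X : Type*} [TopologicalSpace X] [ChartedSpace (Cn n) X]
    (V : Set X) (d : ℤ) : Prop :=
  ∃ (m : ℕ) (Y : Type) (_ : TopologicalSpace Y) (_ : ChartedSpace (Cn m) Y)
    (_ : IsManifold 𝓘(ℂ, Cn m) ω Y) (_ : T2Space Y) (_ : SecondCountableTopology Y)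
    (f : Y → X) (K : Set Y),
    ContMDiff 𝓘(ℂ, Cn m) 𝓘(ℂ, Cn n) ω f ∧ IsCompact K ∧ V = f '' K ∧
    ∀ y ∈ K, (Module.finrank ℂ
      (LinearMap.range (mfderiv 𝓘(ℂ, Cn m) 𝓘(ℂ, Cn n) f y : Cn m →L[ℂ] Cn n).toLinearMap) : ℤ) ≤ d

end Manifold

end PMCurrents

end

noncomputable section

open MeasureTheory

set_option linter.unusedSectionVars false

namespace PMCurrents

/-! ### Local integrability -/

/-! Locally `μ` is a finite sum of direct images `f_* τ`, and `τ` is a constant-coefficient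
differential operator transposed onto the test form, integrated against the locally integrable
kernel `∏ 1/t_j` over the polar variables. Fix `t` and let `I` be the set of polar indices with `t_j
= 0`. If `f` restricted to the stratum `{t_i = 0, i ∈ I}` is submersive at `t`, then `f` and the
coordinates `t_i`, `i ∈ I`, together form a submersion (`surjective_prod_coords`). In suitable local
coordinates `f` is thus a projection and the singular factors depend on fibre variables only, the
remaining factors being smooth near `t`. Integration along the fibres gives a smooth density
(`exists_nhds_hasSmoothDensity`).

The differential operator does no harm: by the product and chain rules it produces smooth
coefficients times derivatives of the test function composed with `f`, and those derivatives pass to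
the density by parts (`IsConstCoeff.hasSmoothDensity`). Forms reduce to functions because the
integrand is linear in the coefficients of the test form in a chart (`topCoeff_wedge_comp`).

So `μ` can fail to be smooth only at images of points of the support of some `α` at which `f`
restricted to some stratum is not submersive. For each term and each stratum these points form a
compact set on which the restricted map has rank at most `n - 1`. The finitely many images have a
compact quasianalytic union (`isCompactQuasianalytic_iUnion`). -/

theorem locallyIntegrable_one_div_const_mul (w : ℂ) :
    LocallyIntegrable (fun z : ℂ => 1 / (w * z)) volume := by
  -- The exponent 1 is below the real dimension 2 of `ℂ`. For `w = 0` both sides of the bound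
  -- vanish.
  refine locallyIntegrable_of_norm_le_rpow (C := ‖w‖⁻¹) (α := 1) ?_ ?_ ?_ ?_
  · simp
  · simp
  · refine Filter.Eventually.of_forall fun z => ?_
    simp [Real.rpow_neg_one, mul_comm]
  · exact (by fun_prop : Measurable fun z : ℂ => 1 / (w * z)).aestronglyMeasurable

theorem _root_.MeasureTheory.LocallyIntegrable.fintype_prod {ι : Type*} [Fintype ι]
    {f : ι → ℂ → ℂ} (hf : ∀ i, LocallyIntegrable (f i) volume) :
    LocallyIntegrable (fun s : ι → ℂ => ∏ i, f i (s i)) volume := by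
  rw [locallyIntegrable_iff]
  intro K hK
  obtain ⟨r, hr⟩ := hK.isBounded.subset_closedBall (0 : ι → ℂ)
  refine IntegrableOn.mono_set (t := Set.univ.pi fun _ : ι => Metric.closedBall (0 : ℂ) r) ?_ ?_
  · rw [IntegrableOn, volume_pi, Measure.restrict_pi_pi]
    exact Integrable.fintype_prod fun i =>
      (hf i).integrableOn_isCompact (isCompact_closedBall _ _)
  · intro s hs i _
    have h := hr hs
    rw [mem_closedBall_zero_iff] at h ⊢
    exact (norm_le_pi_norm s i).trans h

theorem locallyIntegrable_finset_prod_one_div {ι : Type*} [Fintype ι] (R : Finset ι)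
    (w : ι → ℂ) :
    LocallyIntegrable (fun s : ι → ℂ => ∏ j ∈ R, 1 / (w j * s j)) volume := by
  classical
  have h := LocallyIntegrable.fintype_prod (ι := ι)
    (f := fun i z => if i ∈ R then 1 / (w i * z) else 1) fun i => by
      by_cases hi : i ∈ R
      · simpa only [hi, if_true] using locallyIntegrable_one_div_const_mul (w i)
      · simpa only [hi, if_false] using locallyIntegrable_const (1 : ℂ)
  refine h.congr (Filter.Eventually.of_forall fun s => ?_)
  simp only [Finset.prod_ite_mem, Finset.univ_inter]

/-! ### Local integrability under linear isomorphisms and projections -/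

section Haar

variable {E G : Type*} [NormedAddCommGroup E] [NormedSpace ℝ E] [FiniteDimensional ℝ E]
  [MeasurableSpace E] [BorelSpace E] [NormedAddCommGroup G] [NormedSpace ℝ G]
  [FiniteDimensional ℝ G] [MeasurableSpace G] [BorelSpace G]

theorem _root_.MeasureTheory.LocallyIntegrable.comp_continuousLinearEquiv {k : G → ℂ}
    {ν : Measure G} [ν.IsAddHaarMeasure] (hk : LocallyIntegrable k ν) (e : E ≃L[ℝ] G)
    (μ : Measure E) [μ.IsAddHaarMeasure] : LocallyIntegrable (fun x => k (e x)) μ := by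
  -- By uniqueness of Haar measure, the image measure is a multiple of `ν`.
  have : (μ.map e).IsAddHaarMeasure := e.isAddHaarMeasure_map μ
  have h : LocallyIntegrable k (μ.map e) := by
    rw [Measure.isAddLeftInvariant_eq_smul (μ.map e) ν]
    intro x
    obtain ⟨s, hs, hi⟩ := hk x
    refine ⟨s, hs, ?_⟩
    rw [IntegrableOn, Measure.restrict_smul]
    exact hi.smul_measure_nnreal
  exact (locallyIntegrable_map_homeomorph e.toHomeomorph).1 h

theorem _root_.MeasureTheory.LocallyIntegrable.comp_fst {k : G → ℂ}
    {ν : Measure G} [ν.IsAddHaarMeasure] (hk : LocallyIntegrable k ν)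
    (μ : Measure E) [μ.IsAddHaarMeasure] :
    LocallyIntegrable (fun x : G × E => k x.1) (ν.prod μ) := by
  rintro ⟨x, y⟩
  obtain ⟨s, hs, hi⟩ := hk x
  obtain ⟨t, htc, ht⟩ := exists_compact_mem_nhds y
  refine ⟨s ×ˢ t, prod_mem_nhds hs ht, ?_⟩
  rw [IntegrableOn, ← Measure.prod_restrict]
  have : IsFiniteMeasure (μ.restrict t) := ⟨by simpa using htc.measure_lt_top⟩
  exact Integrable.comp_fst hi _

theorem _root_.MeasureTheory.LocallyIntegrable.integrable_mul {k : G → ℂ} {ν : Measure G}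
    (hk : LocallyIntegrable k ν) {c : G → ℂ} (hc : Continuous c) (hc' : HasCompactSupport c) :
    Integrable (fun x => k x * c x) ν := by
  simpa [mul_comm] using hk.integrable_smul_left_of_hasCompactSupport hc hc'

end Haar

/-! ### Functionals with a smooth density -/

section Density

variable {F : Type*} [NormedAddCommGroup F] [NormedSpace ℝ F] [FiniteDimensional ℝ F]
  [MeasurableSpace F] [BorelSpace F] {ν : Measure F} [ν.IsAddHaarMeasure]

/-- The functional `T` on test functions is integration against a smooth function. -/
def HasSmoothDensity (ν : Measure F) (T : (F → ℂ) → ℂ) : Prop :=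
  ∃ b : F → ℂ, ContDiff ℝ ∞ b ∧
    ∀ φ : F → ℂ, ContDiff ℝ ∞ φ → HasCompactSupport φ → T φ = ∫ x, b x * φ x ∂ν

theorem integrable_mul_of_hasCompactSupport {b φ : F → ℂ} (hb : Continuous b)
    (hφ : Continuous φ) (hc : HasCompactSupport φ) : Integrable (fun x => b x * φ x) ν :=
  (hb.mul hφ).integrable_of_hasCompactSupport hc.mul_left

theorem HasSmoothDensity.congr {S T : (F → ℂ) → ℂ} (hT : HasSmoothDensity ν T)
    (h : ∀ φ : F → ℂ, ContDiff ℝ ∞ φ → HasCompactSupport φ → S φ = T φ) :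
    HasSmoothDensity ν S := by
  obtain ⟨b, hb, hT⟩ := hT
  exact ⟨b, hb, fun φ h1 h2 => (h φ h1 h2).trans (hT φ h1 h2)⟩

theorem HasSmoothDensity.zero : HasSmoothDensity ν fun _ => 0 :=
  ⟨fun _ => 0, contDiff_const, fun φ _ _ => by simp⟩

theorem HasSmoothDensity.add {S T : (F → ℂ) → ℂ} (hS : HasSmoothDensity ν S)
    (hT : HasSmoothDensity ν T) : HasSmoothDensity ν fun φ => S φ + T φ := by
  obtain ⟨b, hb, hS⟩ := hS
  obtain ⟨c, hc, hT⟩ := hT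
  refine ⟨fun x => b x + c x, hb.add hc, fun φ h1 h2 => ?_⟩
  beta_reduce
  rw [hS φ h1 h2, hT φ h1 h2, ← integral_add
    (integrable_mul_of_hasCompactSupport hb.continuous h1.continuous h2)
    (integrable_mul_of_hasCompactSupport hc.continuous h1.continuous h2)]
  simp only [add_mul]

theorem HasSmoothDensity.const_mul {T : (F → ℂ) → ℂ} (hT : HasSmoothDensity ν T) (a : ℂ) :
    HasSmoothDensity ν fun φ => a * T φ := by
  obtain ⟨c, hc, hT⟩ := hT
  refine ⟨fun x => a * c x, contDiff_const.mul hc, fun φ h1 h2 => ?_⟩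
  beta_reduce
  rw [hT φ h1 h2, ← integral_const_mul]
  simp only [mul_assoc]

theorem HasSmoothDensity.sum {ι : Type*} (s : Finset ι) {T : ι → (F → ℂ) → ℂ}
    (hT : ∀ i ∈ s, HasSmoothDensity ν (T i)) :
    HasSmoothDensity ν fun φ => ∑ i ∈ s, T i φ := by
  classical
  induction s using Finset.induction_on with
  | empty => simpa using HasSmoothDensity.zero
  | insert i s hi ih =>
    simp only [Finset.sum_insert hi]
    exact (hT i (by simp)).add (ih fun j hj => hT j (by simp [hj]))

/-- Integration by parts: the new density is `-∂_v b`. This absorbs every derivative that falls on a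
test function. -/
theorem HasSmoothDensity.comp_fderiv {T : (F → ℂ) → ℂ} (hT : HasSmoothDensity ν T) (v : F) :
    HasSmoothDensity ν fun φ => T fun x => fderiv ℝ φ x v := by
  obtain ⟨b, hb, hT⟩ := hT
  have hb' : ContDiff ℝ ∞ fun x => fderiv ℝ b x v :=
    (hb.fderiv_right (by simp)).clm_apply contDiff_const
  refine ⟨fun x => -fderiv ℝ b x v, hb'.neg, fun φ h1 h2 => ?_⟩
  have h1' : ContDiff ℝ ∞ fun x => fderiv ℝ φ x v :=
    (h1.fderiv_right (by simp)).clm_apply contDiff_const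
  have h2' : HasCompactSupport fun x => fderiv ℝ φ x v := h2.fderiv_apply ℝ v
  beta_reduce
  rw [hT _ h1' h2', integral_mul_fderiv_eq_neg_fderiv_mul_of_integrable
    (integrable_mul_of_hasCompactSupport hb'.continuous h1.continuous h2)
    (integrable_mul_of_hasCompactSupport hb.continuous h1'.continuous h2')
    (integrable_mul_of_hasCompactSupport hb.continuous h1.continuous h2)
    (fun x _ => hb.differentiable (by simp) x) (fun x _ => h1.differentiable (by simp) x),
    ← integral_neg]
  simp only [neg_mul]

end Density

/-! ### Direct images under projections and submersions -/

section Submersion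

variable {F Z : Type*} [NormedAddCommGroup F] [NormedSpace ℝ F] [FiniteDimensional ℝ F]
  [MeasurableSpace F] [BorelSpace F] (ν : Measure F) [ν.IsAddHaarMeasure]
  [NormedAddCommGroup Z] [NormedSpace ℝ Z] [FiniteDimensional ℝ Z]
  [MeasurableSpace Z] [BorelSpace Z] (ζ : Measure Z) [ζ.IsAddHaarMeasure]

/-- The integral is the value at `0` of the convolution of `k` with `z ↦ c (x, -z)`. Such a
convolution depends smoothly on the parameter `x`, with no regularity of `k` beyond local
integrability. -/
theorem contDiff_integral_mul {k : Z → ℂ} (hk : LocallyIntegrable k ζ) {c : F × Z → ℂ}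
    (hc : ContDiff ℝ ∞ c) (hc' : HasCompactSupport c) :
    ContDiff ℝ ∞ fun x => ∫ z, k z * c (x, z) ∂ζ := by
  set K : Set Z := (fun p : F × Z => -p.2) '' tsupport c with hK
  have hKc : IsCompact K := hc'.isCompact.image (by fun_prop)
  have h := contDiffOn_convolution_right_with_param (𝕜 := ℝ) (n := ⊤) (μ := ζ) (f := k)
    (ContinuousLinearMap.mul ℝ ℂ) (g := fun (x : F) (z : Z) => c (x, -z)) (s := Set.univ)
    isOpen_univ hKc (fun x z _ hz => by
      by_contra hne
      exact hz ⟨(x, -z), subset_tsupport _ hne, by simp⟩) hk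
      (ContDiff.contDiffOn (hc.comp (by fun_prop : ContDiff ℝ ∞ fun p : F × Z => (p.1, -p.2))))
  rw [Set.univ_prod_univ, contDiffOn_univ] at h
  have h2 : ContDiff ℝ ∞ fun x : F => (x, (0 : Z)) := by fun_prop
  have h3 := h.comp h2
  have h4 : (fun x => ∫ z, k z * c (x, z) ∂ζ) = (fun q : F × Z =>
      convolution k (fun z => c (q.1, -z)) (ContinuousLinearMap.mul ℝ ℂ) ζ q.2) ∘
      fun x => (x, 0) := by
    funext x
    simp [MeasureTheory.convolution]
  rw [h4]
  exact h3

/-- By Fubini the density is the fibre integral of `k c`; it is smooth because `k` does not involve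
the base variable. -/
theorem hasSmoothDensity_fst {k : Z → ℂ} (hk : LocallyIntegrable k ζ) {c : F × Z → ℂ}
    (hc : ContDiff ℝ ∞ c) (hc' : HasCompactSupport c) :
    HasSmoothDensity ν fun φ => ∫ p : F × Z, k p.2 * (c p * φ p.1) ∂(ν.prod ζ) := by
  refine ⟨_, contDiff_integral_mul ζ hk hc hc', fun φ h1 _ => ?_⟩
  have hk2 : LocallyIntegrable (fun p : F × Z => k p.2) (ν.prod ζ) := by
    have h := (hk.comp_fst ν).comp_continuousLinearEquiv (ContinuousLinearEquiv.prodComm ℝ F Z)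
      (ν.prod ζ)
    simpa using h
  have hi := hk2.integrable_mul (c := fun p => c p * φ p.1)
    (hc.continuous.mul (h1.continuous.comp continuous_fst)) hc'.mul_right
  beta_reduce
  rw [integral_prod _ hi]
  refine integral_congr_ae (Filter.Eventually.of_forall fun x => ?_)
  beta_reduce
  rw [← integral_mul_const]
  simp only [mul_assoc]

variable {E S : Type*} [NormedAddCommGroup E] [NormedSpace ℝ E] [FiniteDimensional ℝ E]
  [MeasurableSpace E] [BorelSpace E] (μ : Measure E) [μ.IsAddHaarMeasure]
  [NormedAddCommGroup S] [NormedSpace ℝ S] [FiniteDimensional ℝ S]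
  [MeasurableSpace S] [BorelSpace S] (σ : Measure S) [σ.IsAddHaarMeasure]

/-- The missing coordinates are those of the component in `ker A` along a chosen complement. -/
theorem exists_continuousLinearEquiv_extending {A : E →L[ℝ] F} (hA : Function.Surjective A) :
    ∃ (d : ℕ) (e : E ≃L[ℝ] F × (Fin d → ℝ)), ∀ v, (e v).1 = A v := by
  obtain ⟨q, hq⟩ := A.toLinearMap.ker.exists_isCompl
  have hqf := Submodule.finrank_add_eq_of_isCompl hq
  set K := LinearMap.ker A.toLinearMap
  let eK : K ≃ₗ[ℝ] (Fin (Module.finrank ℝ K) → ℝ) := Module.finBasis ℝ K |>.equivFun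
  let pr : E →ₗ[ℝ] K := Submodule.projectionOnto K q hq
  have hinj : Function.Injective (A.toLinearMap.prod (eK.toLinearMap ∘ₗ pr)) := by
    rw [← LinearMap.ker_eq_bot, LinearMap.ker_eq_bot']
    intro v hv
    have h1 : v ∈ K := congrArg Prod.fst hv
    have h2 : pr v = 0 := by
      have := congrArg Prod.snd hv
      simpa using this
    have h3 : pr v = ⟨v, h1⟩ := Submodule.projectionOnto_apply_left hq ⟨v, h1⟩
    rw [h3] at h2
    exact congrArg Subtype.val h2
  have hdim : Module.finrank ℝ E = Module.finrank ℝ (F × (Fin (Module.finrank ℝ K) → ℝ)) := by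
    have h := A.toLinearMap.finrank_range_add_finrank_ker
    rw [LinearMap.range_eq_top.2 hA, finrank_top] at h
    simp only [Module.finrank_prod, Module.finrank_fin_fun]
    exact h.symm
  refine ⟨_, (LinearEquiv.ofInjectiveOfFinrankEq _ hinj hdim).toContinuousLinearEquiv,
    fun v => rfl⟩

/-- Completing `(π, ℓ)` to linear coordinates turns `π` into the projection to the base and `ℓ` into
some of the fibre variables. The change of measure costs only a Haar scalar factor. -/
theorem hasSmoothDensity_linear {k : S → ℂ} (hk : LocallyIntegrable k σ) {π : E →L[ℝ] F}
    {ℓ : E →L[ℝ] S} (hA : Function.Surjective (π.prod ℓ)) {c : E → ℂ} (hc : ContDiff ℝ ∞ c)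
    (hc' : HasCompactSupport c) :
    HasSmoothDensity ν fun φ => ∫ t, k (ℓ t) * (c t * φ (π t)) ∂μ := by
  obtain ⟨d, e, he⟩ := exists_continuousLinearEquiv_extending hA
  let e' : E ≃L[ℝ] F × (S × (Fin d → ℝ)) := e.trans (ContinuousLinearEquiv.prodAssoc ℝ F S _)
  have h1 : ∀ v, (e' v).1 = π v := fun v => congrArg Prod.fst (he v)
  have h2 : ∀ v, (e' v).2.1 = ℓ v := fun v => congrArg Prod.snd (he v)
  have : (μ.map e').IsAddHaarMeasure := e'.isAddHaarMeasure_map μ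
  have : (σ.prod (volume : Measure (Fin d → ℝ))).IsAddHaarMeasure := inferInstance
  have : (ν.prod (σ.prod (volume : Measure (Fin d → ℝ)))).IsAddHaarMeasure :=
    Measure.prod.instIsAddHaarMeasure ν (σ.prod (volume : Measure (Fin d → ℝ)))
  have hs := Measure.isAddLeftInvariant_eq_smul (μ.map e')
    (ν.prod (σ.prod (volume : Measure (Fin d → ℝ))))
  set C := (μ.map e').addHaarScalarFactor (ν.prod (σ.prod (volume : Measure (Fin d → ℝ))))
  have h := hasSmoothDensity_fst ν (σ.prod (volume : Measure (Fin d → ℝ)))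
    (k := fun z => k z.1) (hk.comp_fst volume) (c := fun p => c (e'.symm p))
    (hc.comp e'.symm.contDiff) (hc'.comp_homeomorph e'.symm.toHomeomorph)
  refine (h.const_mul C).congr fun φ _ _ => ?_
  have h3 : ∀ t, k (ℓ t) * (c t * φ (π t)) =
      (fun p : F × (S × (Fin d → ℝ)) => k p.2.1 * (c (e'.symm p) * φ p.1)) (e' t) := fun t => by
    simp only [ContinuousLinearEquiv.symm_apply_apply, h1, h2]
  simp only [h3]
  have h4 := e'.toHomeomorph.measurableEmbedding.integral_map (μ := μ)
    (fun p : F × (S × (Fin d → ℝ)) => k p.2.1 * (c (e'.symm p) * φ p.1))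
  simp only [ContinuousLinearEquiv.coe_toHomeomorph] at h4
  rw [← h4, hs, integral_smul_nnreal_measure]
  rfl

end Submersion

theorem contDiff_continuousLinearMap_det {E : Type*} [NormedAddCommGroup E] [NormedSpace ℝ E]
    [FiniteDimensional ℝ E] : ContDiff ℝ ∞ fun A : E →L[ℝ] E => A.det := by
  let b := Module.finBasis ℝ E
  have h : ∀ A : E →L[ℝ] E, A.det = ∑ σ : Equiv.Perm (Fin (Module.finrank ℝ E)),
      Equiv.Perm.sign σ • ∏ i, (b.coord (σ i)).toContinuousLinearMap (A (b i)) := fun A => by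
    rw [ContinuousLinearMap.det, ← LinearMap.det_toMatrix b, Matrix.det_apply]
    simp [LinearMap.toMatrix_apply]
  simp only [h]
  refine ContDiff.sum fun σ _ => ContDiff.const_smul _ (contDiff_prod fun i _ => ?_)
  exact ((b.coord (σ i)).toContinuousLinearMap.contDiff).comp (contDiff_id.clm_apply contDiff_const)

/-! ### Nonlinear submersions -/

section Submersion

variable {F E S : Type*} [NormedAddCommGroup F] [NormedSpace ℝ F] [FiniteDimensional ℝ F]
  [MeasurableSpace F] [BorelSpace F] (ν : Measure F) [ν.IsAddHaarMeasure]
  [NormedAddCommGroup E] [NormedSpace ℝ E] [FiniteDimensional ℝ E]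
  [MeasurableSpace E] [BorelSpace E] (μ : Measure E) [μ.IsAddHaarMeasure]
  [NormedAddCommGroup S] [NormedSpace ℝ S] [FiniteDimensional ℝ S]
  [MeasurableSpace S] [BorelSpace S] (σ : Measure S) [σ.IsAddHaarMeasure]

/-- Transport of a test function by a diffeomorphism. -/
theorem contDiff_pushforward {h : E → E} (hh : ContDiff ℝ ∞ h) (H : OpenPartialHomeomorph E E)
    (hH : ∀ x, H x = h x) {c : E → ℂ} (hc : ContDiff ℝ ∞ c) (hc' : HasCompactSupport c)
    (hs : tsupport c ⊆ H.source) (hd : ∀ t ∈ tsupport c, (fderiv ℝ h t).det ≠ 0) :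
    ∃ c' : E → ℂ, ContDiff ℝ ∞ c' ∧ HasCompactSupport c' ∧ (∀ y, y ∉ h '' tsupport c → c' y = 0) ∧
      ∀ t ∈ H.source, c t = |(fderiv ℝ h t).det| • c' (h t) := by
  classical
  have hHf : (H : E → E) = h := funext hH
  -- Dividing by the Jacobian in advance makes the change of variables formula return `c` itself.
  let u : E → ℂ := fun t => ((|(fderiv ℝ h t).det| : ℝ) : ℂ)⁻¹ * c t
  have hu : ∀ t ∈ tsupport c, ContDiffAt ℝ ∞ u t := fun t ht => by
    have h1 : ContDiffAt ℝ ∞ (fun t => |(fderiv ℝ h t).det|) t :=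
      (contDiff_continuousLinearMap_det.comp
        (hh.fderiv_right (m := ∞) (by simp))).contDiffAt.abs (hd t ht)
    refine ContDiffAt.mul (ContDiffAt.inv ?_ ?_) hc.contDiffAt
    · exact Complex.ofRealCLM.contDiff.contDiffAt.comp t h1
    · simpa using hd t ht
  have hu0 : ∀ t, t ∉ tsupport c → u t = 0 := fun t ht => by
    simp [u, image_eq_zero_of_notMem_tsupport ht]
  let c' : E → ℂ := fun y => if y ∈ H.target then u (H.symm y) else 0
  have hK : IsCompact (h '' tsupport c) := hc'.isCompact.image hh.continuous
  have h0 : ∀ y, y ∉ h '' tsupport c → c' y = 0 := fun y hy => by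
    by_cases hyt : y ∈ H.target
    · simp only [c', hyt, if_true]
      refine hu0 _ fun hmem => hy ⟨_, hmem, ?_⟩
      rw [← hH, H.right_inv hyt]
    · simp [c', hyt]
  refine ⟨c', ?_, HasCompactSupport.intro hK h0, h0, fun t ht => ?_⟩
  · rw [contDiff_iff_contDiffAt]
    intro y
    by_cases hy : y ∈ h '' tsupport c
    · obtain ⟨t, ht, rfl⟩ := hy
      have hyt : h t ∈ H.target := by rw [← hH]; exact H.map_source (hs ht)
      have hsy : H.symm (h t) = t := by rw [← hH]; exact H.left_inv (hs ht)
      have h1 : ContDiffAt ℝ ∞ H.symm (h t) := by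
        refine H.contDiffAt_symm (f₀' := (fderiv ℝ h t).toContinuousLinearEquivOfDetNeZero
          (hd t ht)) hyt ?_ ?_
        · rw [hsy, hHf]
          simpa using (hh.differentiable (by simp) t).hasFDerivAt
        · rw [hHf]; exact hh.contDiffAt
      have h2 : ContDiffAt ℝ ∞ (fun y => u (H.symm y)) (h t) :=
        ContDiffAt.comp (g := u) (h t) (by rw [hsy]; exact hu t ht) h1
      refine h2.congr_of_eventuallyEq ?_
      filter_upwards [H.open_target.mem_nhds hyt] with z hz
      simp only [c', hz, if_true]
    · refine (contDiffAt_const (c := (0 : ℂ))).congr_of_eventuallyEq ?_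
      filter_upwards [hK.isClosed.isOpen_compl.mem_nhds hy] with z hz using h0 z hz
  · have hyt : h t ∈ H.target := by rw [← hH]; exact H.map_source ht
    have hsy : H.symm (h t) = t := by rw [← hH]; exact H.left_inv ht
    simp only [c', hyt, if_true, hsy, u]
    by_cases htc : t ∈ tsupport c
    · rw [Complex.real_smul, mul_inv_cancel_left₀ (by simpa using hd t htc)]
    · simp [image_eq_zero_of_notMem_tsupport htc]

/-- The inverse function theorem straightens `f` without disturbing `ℓ`, so a change of variables
reduces the claim to `hasSmoothDensity_linear`. -/
theorem exists_nhds_hasSmoothDensity {k : S → ℂ} (hk : LocallyIntegrable k σ) {f : E → F}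
    (hf : ContDiff ℝ ∞ f) {ℓ : E →L[ℝ] S} {t₀ : E}
    (hA : Function.Surjective ((fderiv ℝ f t₀).prod ℓ)) :
    ∃ W : Set E, IsOpen W ∧ t₀ ∈ W ∧ ∀ c : E → ℂ, ContDiff ℝ ∞ c → HasCompactSupport c →
      tsupport c ⊆ W → HasSmoothDensity ν fun φ => ∫ t, k (ℓ t) * (c t * φ (f t)) ∂μ := by
  obtain ⟨d, e, he⟩ := exists_continuousLinearEquiv_extending hA
  -- The map `h` has derivative the identity at `t₀`. The first two components of `e` pull back
  -- under `h` to `f` and `ℓ`.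
  let h : E → E := fun t => e.symm ((f t, ℓ t), (e t).2)
  have hh : ContDiff ℝ ∞ h := e.symm.contDiff.comp
    ((hf.prodMk ℓ.contDiff).prodMk (contDiff_snd.comp e.contDiff))
  have hd₀ : HasFDerivAt h ((ContinuousLinearEquiv.refl ℝ E : E ≃L[ℝ] E) : E →L[ℝ] E) t₀ := by
    have h1 := e.symm.hasFDerivAt.comp t₀ (((hf.differentiable (by simp) t₀).hasFDerivAt.prodMk
      ℓ.hasFDerivAt).prodMk (hasFDerivAt_snd.comp t₀ e.hasFDerivAt))
    refine h1.congr_fderiv ?_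
    ext v
    change e.symm ((fderiv ℝ f t₀).prod ℓ v, (e v).2) = v
    rw [← he, Prod.mk.eta, e.symm_apply_apply]
  let H := hh.contDiffAt.toOpenPartialHomeomorph h hd₀ (by simp)
  have hH : ∀ x, H x = h x := fun x => by
    rw [ContDiffAt.toOpenPartialHomeomorph_coe]
  let W : Set E := H.source ∩ {t | (fderiv ℝ h t).det ≠ 0}
  have hDc : Continuous fun t => (fderiv ℝ h t).det :=
    (contDiff_continuousLinearMap_det.comp (hh.fderiv_right (m := ∞) (by simp))).continuous
  refine ⟨W, H.open_source.inter (isOpen_ne_fun hDc continuous_const),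
    ⟨hh.contDiffAt.mem_toOpenPartialHomeomorph_source hd₀ (by simp), ?_⟩, fun c hc hc' hcW => ?_⟩
  · simp [hd₀.fderiv, ContinuousLinearMap.det]
  obtain ⟨c', hcs, hcc, hc0, hct⟩ := contDiff_pushforward hh H hH hc hc'
    (fun t ht => (hcW ht).1) (fun t ht => (hcW ht).2)
  let π' : E →L[ℝ] F := (ContinuousLinearMap.fst ℝ F S).comp
    ((ContinuousLinearMap.fst ℝ (F × S) (Fin d → ℝ)).comp (e : E →L[ℝ] (F × S) × (Fin d → ℝ)))
  let ℓ' : E →L[ℝ] S := (ContinuousLinearMap.snd ℝ F S).comp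
    ((ContinuousLinearMap.fst ℝ (F × S) (Fin d → ℝ)).comp (e : E →L[ℝ] (F × S) × (Fin d → ℝ)))
  have hA' : Function.Surjective (π'.prod ℓ') := fun y => by
    obtain ⟨v, hv⟩ := hA y
    exact ⟨v, by rw [← hv, ← he]; rfl⟩
  have hπ : ∀ t, π' (h t) = f t := fun t => by simp [π', h]
  have hℓ : ∀ t, ℓ' (h t) = ℓ t := fun t => by simp [ℓ', h]
  refine (hasSmoothDensity_linear ν μ σ hk hA' hcs hcc).congr fun φ _ _ => ?_
  set G : E → ℂ := fun y => k (ℓ' y) * (c' y * φ (π' y)) with hG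
  have hinj : Set.InjOn h H.source := fun x hx y hy hxy =>
    H.injOn hx hy (by rw [hH, hH, hxy])
  have hcv := integral_image_eq_integral_abs_det_fderiv_smul μ H.open_source.measurableSet
    (fun x _ => (hh.differentiable (by simp) x).hasFDerivAt.hasFDerivWithinAt) hinj G
  have h1 : ∫ y in h '' H.source, G y ∂μ = ∫ y, G y ∂μ := by
    refine setIntegral_eq_integral_of_forall_compl_eq_zero fun y hy => ?_
    simp [hG, hc0 y fun ⟨t, ht, hty⟩ => hy ⟨t, (hcW ht).1, hty⟩]
  have h2 : ∫ t in H.source, k (ℓ t) * (c t * φ (f t)) ∂μ = ∫ t, k (ℓ t) * (c t * φ (f t)) ∂μ := by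
    refine setIntegral_eq_integral_of_forall_compl_eq_zero fun t ht => ?_
    rw [image_eq_zero_of_notMem_tsupport fun h' => ht (hcW h').1]
    simp
  rw [← h1, hcv, ← h2]
  refine setIntegral_congr_fun H.open_source.measurableSet fun t ht => ?_
  simp only [hG, hπ, hℓ, hct t ht, Complex.real_smul]
  ring

end Submersion

/-! ### Differential operators with constant coefficients -/

section DiffOp

variable {E F : Type*} [NormedAddCommGroup E] [NormedSpace ℝ E]
  [NormedAddCommGroup F] [NormedSpace ℝ F]

/-- The first order operator `a ∂_v + b ∂_w`. -/
def firstOrder (a b : ℂ) (v w : E) (g : E → ℂ) (t : E) : ℂ :=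
  a * fderiv ℝ g t v + b * fderiv ℝ g t w

/-- Compositions of first order operators with constant coefficients. -/
inductive IsConstCoeff : ((E → ℂ) → E → ℂ) → Prop
  | id : IsConstCoeff fun g => g
  | comp_firstOrder {P : (E → ℂ) → E → ℂ} (a b : ℂ) (v w : E) (hP : IsConstCoeff P) :
      IsConstCoeff fun g => P (firstOrder a b v w g)

theorem _root_.ContDiff.firstOrder {g : E → ℂ} (hg : ContDiff ℝ ∞ g) (a b : ℂ) (v w : E) :
    ContDiff ℝ ∞ (firstOrder a b v w g) := by
  have h : ∀ u : E, ContDiff ℝ ∞ fun t => fderiv ℝ g t u := fun u =>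
    (hg.fderiv_right (by simp)).clm_apply contDiff_const
  exact (contDiff_const.mul (h v)).add (contDiff_const.mul (h w))

theorem tsupport_firstOrder_subset (g : E → ℂ) (a b : ℂ) (v w : E) :
    tsupport (firstOrder a b v w g) ⊆ tsupport g := by
  refine closure_minimal (fun t ht => ?_) (isClosed_tsupport g)
  by_contra h
  have h0 : fderiv ℝ g t = 0 := image_eq_zero_of_notMem_tsupport
    fun h' => h (tsupport_fderiv_subset ℝ h')
  exact ht (by simp [firstOrder, h0])

theorem firstOrder_add {g h : E → ℂ} (hg : ContDiff ℝ ∞ g) (hh : ContDiff ℝ ∞ h) (a b : ℂ)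
    (v w : E) : firstOrder a b v w (fun t => g t + h t) =
      fun t => firstOrder a b v w g t + firstOrder a b v w h t := by
  funext t
  have : fderiv ℝ (fun t => g t + h t) t = fderiv ℝ g t + fderiv ℝ h t :=
    fderiv_fun_add (hg.differentiable (by simp) t) (hh.differentiable (by simp) t)
  simp only [firstOrder, this, add_apply]
  ring

theorem firstOrder_mul {g h : E → ℂ} (hg : ContDiff ℝ ∞ g) (hh : ContDiff ℝ ∞ h) (a b : ℂ)
    (v w : E) (t : E) : firstOrder a b v w (fun t => g t * h t) t =
      firstOrder a b v w g t * h t + g t * firstOrder a b v w h t := by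
  have : fderiv ℝ (fun t => g t * h t) t = _ :=
    fderiv_fun_mul (hg.differentiable (by simp) t) (hh.differentiable (by simp) t)
  simp only [firstOrder, this, add_apply, smul_apply,
    smul_eq_mul]
  ring

namespace IsConstCoeff

variable {P Q : (E → ℂ) → E → ℂ}

theorem firstOrder (a b : ℂ) (v w : E) : IsConstCoeff (firstOrder a b v w) :=
  comp_firstOrder a b v w .id

theorem comp (hP : IsConstCoeff P) (hQ : IsConstCoeff Q) : IsConstCoeff fun g => P (Q g) := by
  induction hQ with
  | id => exact hP
  | comp_firstOrder a b v w _ ih => exact comp_firstOrder a b v w ih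

theorem iterate (hP : IsConstCoeff P) (m : ℕ) : IsConstCoeff (P^[m]) := by
  induction m with
  | zero => exact .id
  | succ m ih => exact ih.comp hP

theorem foldr {ι : Type*} {A : ι → (E → ℂ) → E → ℂ} (hA : ∀ i, IsConstCoeff (A i))
    (l : List ι) : IsConstCoeff fun g => l.foldr A g := by
  induction l with
  | nil => exact .id
  | cons i l ih => exact (hA i).comp ih

theorem contDiff (hP : IsConstCoeff P) {g : E → ℂ} (hg : ContDiff ℝ ∞ g) :
    ContDiff ℝ ∞ (P g) := by
  induction hP generalizing g with
  | id => exact hg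
  | comp_firstOrder a b v w _ ih => exact ih (hg.firstOrder a b v w)

theorem tsupport_subset (hP : IsConstCoeff P) (g : E → ℂ) : tsupport (P g) ⊆ tsupport g := by
  induction hP generalizing g with
  | id => exact subset_rfl
  | comp_firstOrder a b v w _ ih => exact (ih _).trans (tsupport_firstOrder_subset g a b v w)

theorem hasCompactSupport (hP : IsConstCoeff P) {g : E → ℂ} (hg : HasCompactSupport g) :
    HasCompactSupport (P g) :=
  hg.mono' ((subset_tsupport _).trans (hP.tsupport_subset g))

theorem map_add (hP : IsConstCoeff P) {g h : E → ℂ} (hg : ContDiff ℝ ∞ g)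
    (hh : ContDiff ℝ ∞ h) : P (fun t => g t + h t) = fun t => P g t + P h t := by
  induction hP generalizing g h with
  | id => rfl
  | comp_firstOrder a b v w _ ih =>
    beta_reduce
    rw [firstOrder_add hg hh]
    exact ih (hg.firstOrder a b v w) (hh.firstOrder a b v w)

theorem map_zero (hP : IsConstCoeff P) : (P fun _ => 0) = fun _ => 0 := by
  have h := hP.map_add (contDiff_const (c := (0 : ℂ))) (contDiff_const (c := (0 : ℂ)))
  simp only [add_zero] at h
  funext t
  simpa using congrFun h t

theorem map_sum (hP : IsConstCoeff P) {ι : Type*} (s : Finset ι) {g : ι → E → ℂ}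
    (hg : ∀ i ∈ s, ContDiff ℝ ∞ (g i)) :
    P (fun t => ∑ i ∈ s, g i t) = fun t => ∑ i ∈ s, P (g i) t := by
  classical
  induction s using Finset.induction_on with
  | empty => simpa using hP.map_zero
  | insert i s hi ih =>
    simp only [Finset.sum_insert hi]
    rw [hP.map_add (hg i (by simp)) (ContDiff.sum fun j hj => hg j (by simp [hj])),
      ih fun j hj => hg j (by simp [hj])]

variable [FiniteDimensional ℝ E] [FiniteDimensional ℝ F] [MeasurableSpace F] [BorelSpace F] {ν : Measure F}
  [ν.IsAddHaarMeasure] [MeasurableSpace E] [BorelSpace E] {μ : Measure E}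

/-- If the functionals `φ ↦ ∫ k c (φ ∘ f)`, with `c` supported in `W`, have smooth densities, then
so have the functionals `φ ↦ ∫ k P (c (φ ∘ f))`. -/
theorem hasSmoothDensity (hP : IsConstCoeff P) {k : E → ℂ} (hk : LocallyIntegrable k μ)
    {f : E → F} (hf : ContDiff ℝ ∞ f) {W : Set E}
    (hW : ∀ c : E → ℂ, ContDiff ℝ ∞ c → HasCompactSupport c → tsupport c ⊆ W →
      HasSmoothDensity ν fun φ => ∫ t, k t * (c t * φ (f t)) ∂μ)
    {c : E → ℂ} (hc : ContDiff ℝ ∞ c) (hc' : HasCompactSupport c) (hcW : tsupport c ⊆ W) :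
    HasSmoothDensity ν fun φ => ∫ t, k t * P (fun t => c t * φ (f t)) t ∂μ := by
  induction hP generalizing c with
  | id => exact hW c hc hc' hcW
  | @comp_firstOrder P a b v w hP ih =>
    let B := Module.finBasis ℝ F
    let D : Fin (Module.finrank ℝ F) → E → ℂ := fun i t =>
      PMCurrents.firstOrder a b v w (fun t => ((B.coord i (f t) : ℝ) : ℂ)) t
    have hcoord : ∀ i, ContDiff ℝ ∞ fun t => ((B.coord i (f t) : ℝ) : ℂ) := fun i =>
      Complex.ofRealCLM.contDiff.comp (((B.coord i).toContinuousLinearMap.contDiff).comp hf)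
    have hD : ∀ i, ContDiff ℝ ∞ fun t => c t * D i t := fun i =>
      hc.mul ((hcoord i).firstOrder a b v w)
    -- With `L` the first order operator and `f_i` the real coordinates of `f`: `L (c · φ∘f) = (L c)
    -- · φ∘f + ∑ c · L f_i · (∂_i φ)∘f`.
    have key : ∀ φ : F → ℂ, ContDiff ℝ ∞ φ →
        PMCurrents.firstOrder a b v w (fun t => c t * φ (f t)) =
          fun t => PMCurrents.firstOrder a b v w c t * φ (f t) +
            ∑ i, (c t * D i t) * fderiv ℝ φ (f t) (B i) := fun φ hφ => by
      funext t
      rw [firstOrder_mul hc (h := fun t => φ (f t)) (hφ.comp hf)]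
      congr 1
      have hchain : ∀ u, fderiv ℝ (fun t => φ (f t)) t u =
          ∑ i, fderiv ℝ (fun t => ((B.coord i (f t) : ℝ) : ℂ)) t u * fderiv ℝ φ (f t) (B i) := by
        intro u
        have h1 : fderiv ℝ (fun t => φ (f t)) t u = fderiv ℝ φ (f t) (fderiv ℝ f t u) := by
          have := fderiv_comp (𝕜 := ℝ) t (hφ.differentiable (by simp) (f t))
            (hf.differentiable (by simp) t)
          exact congrArg (fun A : E →L[ℝ] ℂ => A u) this
        have h2 : ∀ i, fderiv ℝ (fun t => ((B.coord i (f t) : ℝ) : ℂ)) t u =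
            ((B.coord i (fderiv ℝ f t u) : ℝ) : ℂ) := fun i => by
          have := (Complex.ofRealCLM.hasFDerivAt.comp t
            ((B.coord i).toContinuousLinearMap.hasFDerivAt.comp t
              (hf.differentiable (by simp) t).hasFDerivAt)).fderiv
          exact congrArg (fun A : E →L[ℝ] ℂ => A u) this
        rw [h1]
        conv_lhs => rw [← B.sum_repr (fderiv ℝ f t u)]
        simp only [_root_.map_sum, map_smul, Complex.real_smul, h2]
        rfl
      simp only [D, PMCurrents.firstOrder, hchain, Finset.mul_sum, ← Finset.sum_add_distrib]
      exact Finset.sum_congr rfl fun i _ => by ring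
    -- The induction hypothesis applies to the coefficients `L c` and `c · L f_i`, all still
    -- supported in `W`. The functionals in the sum are evaluated at `∂_i φ`, which `comp_fderiv`
    -- handles.
    refine ((ih (hc.firstOrder a b v w)
      (hc'.mono' ((subset_tsupport _).trans (tsupport_firstOrder_subset c a b v w)))
      ((tsupport_firstOrder_subset c a b v w).trans hcW)).add
      (HasSmoothDensity.sum Finset.univ fun i _ => ((ih (hD i) hc'.mul_right
        ((tsupport_mul_subset_left).trans hcW)).comp_fderiv (B i)))).congr fun φ hφ _ => ?_
    have hg₀ : ContDiff ℝ ∞ fun t => PMCurrents.firstOrder a b v w c t * φ (f t) :=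
      (hc.firstOrder a b v w).mul (hφ.comp hf)
    have hg : ∀ i, ContDiff ℝ ∞ fun t => (c t * D i t) * fderiv ℝ φ (f t) (B i) := fun i =>
      (hD i).mul (((hφ.fderiv_right (m := ∞) (by simp)).clm_apply contDiff_const).comp hf)
    have hint₀ : Integrable (fun t => k t *
        P (fun t => PMCurrents.firstOrder a b v w c t * φ (f t)) t) μ :=
      hk.integrable_mul (hP.contDiff hg₀).continuous (hP.hasCompactSupport
        (HasCompactSupport.mul_right (hc'.mono' ((subset_tsupport _).trans
          (tsupport_firstOrder_subset c a b v w)))))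
    have hint : ∀ i, Integrable (fun t => k t *
        P (fun t => (c t * D i t) * fderiv ℝ φ (f t) (B i)) t) μ := fun i =>
      hk.integrable_mul (hP.contDiff (hg i)).continuous (hP.hasCompactSupport
        (HasCompactSupport.mul_right (HasCompactSupport.mul_right hc')))
    beta_reduce
    rw [key φ hφ, hP.map_add hg₀ (ContDiff.sum fun i _ => hg i), hP.map_sum _ fun i _ => hg i]
    simp only [mul_add, Finset.mul_sum]
    rw [integral_add hint₀ (integrable_finsetSum _ fun i _ => hint i),
      integral_finsetSum _ fun i _ => hint i]

end IsConstCoeff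

end DiffOp

theorem contDiff_of_tsupport {E G : Type*} [NormedAddCommGroup E] [NormedSpace ℝ E]
    [NormedAddCommGroup G] [NormedSpace ℝ G] {f : E → G}
    (hf : ∀ x ∈ tsupport f, ContDiffAt ℝ ∞ f x) : ContDiff ℝ ∞ f :=
  contMDiff_iff_contDiff.1 (contMDiff_of_tsupport fun x hx => (hf x hx).contMDiffAt)

/-! ### Elementary currents -/

theorem isConstCoeff_dHol {N : ℕ} (j : Fin N) : IsConstCoeff (dHol j) := by
  have h : dHol j = firstOrder (1 / 2) (-(Complex.I / 2)) (EuclideanSpace.single j (1 : ℂ))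
      (EuclideanSpace.single j Complex.I) := by
    funext g t
    simp only [dHol, firstOrder]
    ring
  rw [h]
  exact .firstOrder _ _ _ _

theorem isConstCoeff_neg_dBar {N : ℕ} (j : Fin N) :
    IsConstCoeff fun (g : Cn N → ℂ) t => -(dBar j g t) := by
  have h : (fun (g : Cn N → ℂ) t => -(dBar j g t)) =
      firstOrder (-(1 / 2)) (-(Complex.I / 2)) (EuclideanSpace.single j (1 : ℂ))
      (EuclideanSpace.single j Complex.I) := by
    funext g t
    simp only [dBar, firstOrder]
    ring
  rw [h]
  exact .firstOrder _ _ _ _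

/-- The coordinates with index in `I`, as an `ℝ`-linear map. -/
def coords {N : ℕ} (I : Finset (Fin N)) : Cn N →L[ℝ] (I → ℂ) :=
  ContinuousLinearMap.pi fun j => (EuclideanSpace.proj j.1 : Cn N →L[ℂ] ℂ).restrictScalars ℝ

theorem coords_apply {N : ℕ} (I : Finset (Fin N)) (t : Cn N) (j : I) : coords I t j = t j := rfl

theorem locallyIntegrable_prod_one_div {N : ℕ} (R : Finset (Fin N)) (w : Fin N → ℂ) :
    LocallyIntegrable (fun t : Cn N => ∏ j ∈ R, 1 / (w j * t j)) volume :=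
  (locallyIntegrable_finset_prod_one_div R w).comp_continuousLinearEquiv
    (PiLp.continuousLinearEquiv 2 ℝ fun _ : Fin N => ℂ) volume

/-- Direct images of `∏_{j ∈ R} 1/t_j`, times a test function supported near `t₀`, under a map
whose restriction to the stratum of the coordinate hyperplanes through `t₀` is a submersion. -/
theorem exists_nhds_hasSmoothDensity_prod_one_div {N n : ℕ} (R : Finset (Fin N)) {w : Fin N → ℂ}
    (hw : ∀ j, w j ≠ 0) {f : Cn N → Cn n} (hf : ContDiff ℝ ∞ f) {t₀ : Cn N}
    (hA : Function.Surjective ((fderiv ℝ f t₀).prod (coords (R.filter fun j => t₀ j = 0)))) :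
    ∃ W : Set (Cn N), IsOpen W ∧ t₀ ∈ W ∧ ∀ c : Cn N → ℂ, ContDiff ℝ ∞ c → HasCompactSupport c →
      tsupport c ⊆ W → HasSmoothDensity volume fun φ : Cn n → ℂ =>
        ∫ t, (∏ j ∈ R, 1 / (w j * t j)) * (c t * φ (f t)) := by
  -- The factors with `t₀ j ≠ 0` are smooth near `t₀` and are absorbed into `c`. Only those indexed
  -- by `I` remain in the kernel, and they are functions of `coords I`.
  set I := R.filter fun j => t₀ j = 0 with hI
  set J := R.filter fun j => ¬ t₀ j = 0 with hJ
  obtain ⟨W, hWo, htW, hW⟩ := exists_nhds_hasSmoothDensity (volume : Measure (Cn n))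
    (volume : Measure (Cn N)) (volume : Measure (I → ℂ))
    (k := fun s => ∏ j, 1 / (w j.1 * s j))
    (locallyIntegrable_finset_prod_one_div Finset.univ fun j : I => w j.1) hf hA
  have hJo : IsOpen {t : Cn N | ∀ j ∈ J, t j ≠ 0} := by
    simp only [Set.ofPred_forall]
    exact isOpen_biInter_finset fun j _ => isOpen_ne_fun (by fun_prop) continuous_const
  refine ⟨W ∩ {t | ∀ j ∈ J, t j ≠ 0}, hWo.inter hJo,
    ⟨htW, fun j hj => (Finset.mem_filter.1 hj).2⟩, fun c hc hc' hcW => ?_⟩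
  have hs : tsupport (fun t : Cn N => (∏ j ∈ J, 1 / (w j * t j)) * c t) ⊆ tsupport c :=
    tsupport_mul_subset_right
  have hcd : ContDiff ℝ ∞ fun t : Cn N => (∏ j ∈ J, 1 / (w j * t j)) * c t := by
    refine contDiff_of_tsupport fun t ht => ?_
    have ht' := (hcW (hs ht)).2
    refine ContDiffAt.mul (contDiffAt_prod fun j hj => ?_) hc.contDiffAt
    have h1 : ContDiff ℝ ∞ fun t : Cn N => w j * t j := contDiff_const.mul
      ((EuclideanSpace.proj j : Cn N →L[ℂ] ℂ).restrictScalars ℝ).contDiff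
    simp only [one_div]
    exact h1.contDiffAt.inv (mul_ne_zero (hw j) (ht' j hj))
  refine (hW _ hcd hc'.mul_left ((hs.trans hcW).trans Set.inter_subset_left)).congr
    fun φ _ _ => integral_congr_ae (Filter.Eventually.of_forall fun t => ?_)
  simp only [coords_apply]
  rw [← Finset.prod_filter_mul_prod_filter_not R fun j => t₀ j = 0,
    Finset.prod_coe_sort I fun j => 1 / (w j * t j)]
  ring

namespace ElementaryCurrent

variable {N : ℕ} (τ : ElementaryCurrent N)

/-- The locally integrable factor of an elementary current. -/
def kernel (t : Cn N) : ℂ := ∏ j ∈ τ.pv ∪ τ.res, 1 / (((τ.ord j).factorial : ℂ) * t j)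

/-- The differential operator of an elementary current. -/
def diffOp (g : Cn N → ℂ) : Cn N → ℂ := (List.finRange N).foldr τ.transposed g

theorem scalarPart_eq (g : Cn N → ℂ) : τ.scalarPart g = ∫ t, τ.kernel t * τ.diffOp g t := rfl

theorem isConstCoeff_diffOp : IsConstCoeff τ.diffOp := by
  refine IsConstCoeff.foldr (A := τ.transposed) (fun j => ?_) _
  by_cases h1 : j ∈ τ.pv
  · have : τ.transposed j = (dHol j)^[τ.ord j] := by
      funext g
      simp only [transposed, h1, if_true]
    rw [this]
    exact (isConstCoeff_dHol j).iterate _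
  by_cases h2 : j ∈ τ.res
  · have : τ.transposed j = fun g t => -(dBar j ((dHol j)^[τ.ord j] g) t) := by
      funext g
      simp only [transposed, h1, h2, if_true, if_false]
    rw [this]
    exact (isConstCoeff_neg_dBar j).comp ((isConstCoeff_dHol j).iterate _)
  · have : τ.transposed j = fun g => g := by
      funext g
      simp only [transposed, h1, h2, if_false]
    rw [this]
    exact .id

theorem locallyIntegrable_kernel : LocallyIntegrable τ.kernel volume :=
  locallyIntegrable_prod_one_div _ _

theorem scalarPart_sum {ι : Type*} (s : Finset ι) {g : ι → Cn N → ℂ}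
    (hg : ∀ i ∈ s, ContDiff ℝ ∞ (g i)) (hg' : ∀ i ∈ s, HasCompactSupport (g i)) :
    τ.scalarPart (fun t => ∑ i ∈ s, g i t) = ∑ i ∈ s, τ.scalarPart (g i) := by
  simp only [scalarPart_eq]
  rw [τ.isConstCoeff_diffOp.map_sum s hg]
  simp only [Finset.mul_sum]
  exact integral_finsetSum _ fun i hi => τ.locallyIntegrable_kernel.integrable_mul
    (τ.isConstCoeff_diffOp.contDiff (hg i hi)).continuous
    (τ.isConstCoeff_diffOp.hasCompactSupport (hg' i hi))

theorem exists_nhds_hasSmoothDensity_scalarPart {n : ℕ} {f : Cn N → Cn n} (hf : ContDiff ℝ ∞ f)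
    {t₀ : Cn N} (hA : Function.Surjective
      ((fderiv ℝ f t₀).prod (coords ((τ.pv ∪ τ.res).filter fun j => t₀ j = 0)))) :
    ∃ W : Set (Cn N), IsOpen W ∧ t₀ ∈ W ∧ ∀ c : Cn N → ℂ, ContDiff ℝ ∞ c → HasCompactSupport c →
      tsupport c ⊆ W → HasSmoothDensity volume fun φ : Cn n → ℂ =>
        τ.scalarPart fun t => c t * φ (f t) := by
  obtain ⟨W, hWo, htW, hW⟩ := exists_nhds_hasSmoothDensity_prod_one_div (τ.pv ∪ τ.res)
    (w := fun j => ((τ.ord j).factorial : ℂ))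
    (fun j => Nat.cast_ne_zero.2 (Nat.factorial_ne_zero _)) hf hA
  exact ⟨W, hWo, htW, fun c hc hc' hcW => τ.isConstCoeff_diffOp.hasSmoothDensity
    τ.locallyIntegrable_kernel hf hW hc hc' hcW⟩

end ElementaryCurrent

/-! ### Exterior algebra of `ℂⁿ` -/

theorem wedge_apply {n p q : ℕ} (θ : Alt n p) (η : Alt n q) (v : Fin (p + q) → Cn n) :
    wedge θ η v = (1 / ((p.factorial : ℂ) * (q.factorial : ℂ))) *
      ∑ σ : Equiv.Perm (Fin (p + q)), Equiv.Perm.sign σ •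
        (θ (fun i => v (σ (Fin.castAdd q i))) * η (fun i => v (σ (Fin.natAdd p i)))) := by
  rw [wedge, ContinuousAlternatingMap.smul_apply,
    ContinuousMultilinearMap.alternatization_apply_apply]
  rfl

theorem topCoeff_of_eq {n k : ℕ} (h : k = 2 * n) (θ : Alt n k) :
    topCoeff θ = θ fun i => realFrame n (Fin.cast h i) := dif_pos h

theorem topCoeff_of_ne {n k : ℕ} (h : k ≠ 2 * n) (θ : Alt n k) : topCoeff θ = 0 := dif_neg h

/-- The real coordinates of `ℂⁿ` with respect to `realFrame`. -/
def realCoord (n : ℕ) (k : Fin (2 * n)) : Cn n →L[ℝ] ℂ :=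
  Complex.ofRealCLM.comp ((if k.1 % 2 = 0 then Complex.reCLM else Complex.imCLM).comp
    ((EuclideanSpace.proj (⟨k.1 / 2, by omega⟩ : Fin n) : Cn n →L[ℂ] ℂ).restrictScalars ℝ))

theorem realCoord_apply (n : ℕ) (k : Fin (2 * n)) (v : Cn n) : realCoord n k v =
    (((if k.1 % 2 = 0 then (v (⟨k.1 / 2, by omega⟩ : Fin n)).re
      else (v (⟨k.1 / 2, by omega⟩ : Fin n)).im : ℝ) : ℂ)) := by
  unfold realCoord
  split_ifs <;> rfl

theorem realCoord_realFrame {n : ℕ} (k l : Fin (2 * n)) :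
    realCoord n k (realFrame n l) = if k = l then 1 else 0 := by
  rw [realCoord_apply, realFrame]
  simp only [PiLp.single_apply, Fin.ext_iff]
  by_cases hkl : k.1 = l.1
  · simp only [hkl, if_true]
    split_ifs <;> simp
  · simp only [hkl, if_false]
    by_cases h2 : k.1 / 2 = l.1 / 2
    · simp only [h2, if_true]
      have : k.1 % 2 ≠ l.1 % 2 := by omega
      split_ifs <;> first | omega | simp
    · simp [h2]

theorem sum_realCoord_smul_realFrame {n : ℕ} (v : Cn n) :
    v = ∑ k, (realCoord n k v).re • realFrame n k := by
  have h : ∀ j : Fin n, v j = (∑ k, (realCoord n k v).re • realFrame n k) j := fun j => by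
    have h0 : ∀ k : Fin (2 * n), ((realCoord n k v).re • realFrame n k) j =
        if k.1 / 2 = j.1 then (if k.1 % 2 = 0 then (((v j).re : ℝ) : ℂ)
          else ((v j).im : ℝ) * Complex.I) else 0 := fun k => by
      rw [realCoord_apply, realFrame, PiLp.smul_apply, PiLp.single_apply,
        Complex.ofReal_re]
      by_cases hj : k.1 / 2 = j.1
      · have : (⟨k.1 / 2, by omega⟩ : Fin n) = j := Fin.ext hj
        simp only [hj, if_true]
        split_ifs <;> simp
      · have : ¬ (j = (⟨k.1 / 2, by omega⟩ : Fin n)) := fun h => hj (by rw [h])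
        simp only [this, hj, if_false, smul_zero]
    have hsum : (∑ k, (realCoord n k v).re • realFrame n k) j =
        ∑ k, ((realCoord n k v).re • realFrame n k) j :=
      map_sum (EuclideanSpace.proj j : Cn n →L[ℂ] ℂ) _ _
    rw [hsum]
    simp only [h0]
    have hne : (⟨2 * j.1, by omega⟩ : Fin (2 * n)) ≠ ⟨2 * j.1 + 1, by omega⟩ := by
      simp [Fin.ext_iff]
    rw [← Finset.sum_subset (Finset.subset_univ
      ({⟨2 * j.1, by omega⟩, ⟨2 * j.1 + 1, by omega⟩} : Finset (Fin (2 * n)))),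
      Finset.sum_pair hne]
    · have h1 : 2 * j.1 / 2 = j.1 := by omega
      have h2 : (2 * j.1 + 1) / 2 = j.1 := by omega
      have h3 : 2 * j.1 % 2 = 0 := by omega
      have h4 : ¬ (2 * j.1 + 1) % 2 = 0 := by omega
      simp only [h1, h2, h3, h4, if_true, if_false, Complex.re_add_im]
    · intro k _ hk
      simp only [Finset.mem_insert, Finset.mem_singleton, Fin.ext_iff] at hk
      have : ¬ k.1 / 2 = j.1 := by omega
      simp only [this, if_false]
  ext j
  exact h j

/-- Only multilinearity is used: `J` runs over all index maps, so no increasing multi-indices need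
be selected. -/
theorem alt_apply_eq_sum {n r : ℕ} (θ : Alt n r) (v : Fin r → Cn n) :
    θ v = ∑ J : Fin r → Fin (2 * n),
      (∏ i, realCoord n (J i) (v i)) * θ fun i => realFrame n (J i) := by
  have h1 : v = fun i => ∑ k, (realCoord n k (v i)).re • realFrame n k :=
    funext fun i => sum_realCoord_smul_realFrame (v i)
  have h2 := θ.toMultilinearMap.map_sum (fun i k => (realCoord n k (v i)).re • realFrame n k)
  rw [← h1] at h2
  refine h2.trans (Finset.sum_congr rfl fun J _ => ?_)
  rw [θ.toMultilinearMap.map_smul_univ (fun i => (realCoord n (J i) (v i)).re)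
    fun i => realFrame n (J i), Complex.real_smul, Complex.ofReal_prod]
  congr 1

/-- The coefficient of `θ (e_J)` in `topCoeff (A ∧ D^* θ)`. -/
def pullbackCoeff {N n p r : ℕ} (A : Alt N p) (D : Cn N →L[ℝ] Cn n) (J : Fin r → Fin (2 * n)) :
    ℂ :=
  if h : p + r = 2 * N then
    (1 / ((p.factorial : ℂ) * (r.factorial : ℂ))) *
      ∑ σ : Equiv.Perm (Fin (p + r)), Equiv.Perm.sign σ •
        (A (fun i => realFrame N (Fin.cast h (σ (Fin.castAdd r i)))) *
          ∏ i, realCoord n (J i) (D (realFrame N (Fin.cast h (σ (Fin.natAdd p i))))))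
  else 0

/-- This separates the test form, which enters through its scalar coefficients `θ (e_J)`, from the
data of the current, thereby reducing forms to functions. -/
theorem topCoeff_wedge_comp {N n p r : ℕ} (A : Alt N p) (θ : Alt n r) (D : Cn N →L[ℝ] Cn n) :
    topCoeff (wedge A (θ.compContinuousLinearMap D)) =
      ∑ J : Fin r → Fin (2 * n), pullbackCoeff A D J * θ fun i => realFrame n (J i) := by
  by_cases h : p + r = 2 * N
  · simp only [topCoeff_of_eq h, wedge_apply, pullbackCoeff, h, dif_pos,
      ContinuousAlternatingMap.compContinuousLinearMap_apply, Function.comp_def]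
    simp only [alt_apply_eq_sum θ fun i => D _, Finset.mul_sum, Finset.sum_mul, Finset.smul_sum]
    rw [Finset.sum_comm]
    refine Finset.sum_congr rfl fun J _ => Finset.sum_congr rfl fun σ _ => ?_
    simp only [Units.smul_def, zsmul_eq_mul]
    ring
  · simp [topCoeff_of_ne h, pullbackCoeff, h]

theorem contDiff_pullbackCoeff {N n p r : ℕ} {A : Cn N → Alt N p}
    {D : Cn N → Cn N →L[ℝ] Cn n} (hA : ∀ v, ContDiff ℝ ∞ fun t => A t v) (hD : ContDiff ℝ ∞ D)
    (J : Fin r → Fin (2 * n)) : ContDiff ℝ ∞ fun t => pullbackCoeff (A t) (D t) J := by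
  by_cases h : p + r = 2 * N
  · simp only [pullbackCoeff, h, dif_pos]
    refine contDiff_const.mul (ContDiff.sum fun σ _ => ContDiff.const_smul _ ((hA _).mul
      (contDiff_prod fun i _ => ?_)))
    exact (realCoord n (J i)).contDiff.comp (hD.clm_apply contDiff_const)
  · simp only [pullbackCoeff, h, dif_neg, not_false_iff]
    exact contDiff_const

theorem contDiff_wedge_apply {N p q : ℕ} {A : Cn N → Alt N p} (hA : ∀ v, ContDiff ℝ ∞ fun t => A t v)
    (η : Alt N q) (v : Fin (p + q) → Cn N) : ContDiff ℝ ∞ fun t => wedge (A t) η v := by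
  simp only [wedge_apply]
  exact contDiff_const.mul (ContDiff.sum fun σ _ =>
    ContDiff.const_smul _ ((hA _).mul contDiff_const))

theorem wedgeOneForms_apply {n q : ℕ} (l : Fin q → (Cn n →L[ℝ] ℂ)) (v : Fin q → Cn n) :
    wedgeOneForms l v = ∑ π : Equiv.Perm (Fin q), Equiv.Perm.sign π • ∏ i, l i (v (π i)) := by
  rw [wedgeOneForms, ContinuousMultilinearMap.alternatization_apply_apply]
  rfl

theorem topCoeff_wedge_smul {n k r : ℕ} (c : ℂ) (η : Alt n k) (θ : Alt n r) :
    topCoeff (wedge (c • η) θ) = c * topCoeff (wedge η θ) := by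
  by_cases h : k + r = 2 * n
  · simp only [topCoeff_of_eq h, wedge_apply, ContinuousAlternatingMap.smul_apply, smul_eq_mul,
      Finset.mul_sum, Units.smul_def, zsmul_eq_mul]
    exact Finset.sum_congr rfl fun σ _ => by ring
  · simp [topCoeff_of_ne h]

theorem topCoeff_wedge_sum {n k r : ℕ} {ι : Type*} (s : Finset ι) (η : ι → Alt n k) (θ : Alt n r) :
    topCoeff (wedge (∑ i ∈ s, η i) θ) = ∑ i ∈ s, topCoeff (wedge (η i) θ) := by
  by_cases h : k + r = 2 * n
  · simp only [topCoeff_of_eq h, wedge_apply, ContinuousAlternatingMap.sum_apply,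
      Finset.mul_sum, Finset.sum_mul, Finset.smul_sum]
    exact Finset.sum_comm
  · simp [topCoeff_of_ne h]

theorem exists_perm_natAdd_eq {k r : ℕ} {J : Fin r → Fin (k + r)} (hJ : Function.Injective J) :
    ∃ ρ : Equiv.Perm (Fin (k + r)), ∀ i, ρ (Fin.natAdd k i) = J i := by
  classical
  obtain ⟨g, hg⟩ := Set.MapsTo.exists_equiv_extend_of_card_eq (α := Fin (k + r))
    (t := (Finset.univ : Finset (Fin (k + r)))) (by simp)
    (s := Set.range (Fin.natAdd k : Fin r → Fin (k + r)))
    -- The values on the first `k` indices are placeholders; only injectivity on the last `r`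
    -- matters.
    (f := Fin.addCases (fun i => Fin.castAdd r i) J) (by simp [Set.MapsTo]) (by
      rintro _ ⟨i, rfl⟩ _ ⟨j, rfl⟩ hij
      simp only [Fin.addCases_right] at hij
      rw [hJ hij])
  refine ⟨g.trans (Equiv.subtypeUnivEquiv fun x => Finset.mem_univ x), fun i => ?_⟩
  have := hg (Fin.natAdd k i) ⟨i, rfl⟩
  simpa using this

theorem exists_sumCongr_of_castAdd {k r : ℕ} {κ : Equiv.Perm (Fin (k + r))}
    (hκ : ∀ i : Fin k, ∃ j : Fin k, κ (Fin.castAdd r i) = Fin.castAdd r j) :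
    ∃ (π₁ : Equiv.Perm (Fin k)) (π₂ : Equiv.Perm (Fin r)),
      κ = finSumFinEquiv.permCongr (π₁.sumCongr π₂) := by
  have h : finSumFinEquiv.symm.permCongr κ ∈ (Equiv.Perm.sumCongrHom (Fin k) (Fin r)).range := by
    refine Equiv.Perm.mem_sumCongrHom_range_of_perm_mapsTo_inl ?_
    rintro _ ⟨i, rfl⟩
    obtain ⟨j, hj⟩ := hκ i
    exact ⟨j, by simp [Equiv.permCongr_apply, hj]⟩
  obtain ⟨⟨π₁, π₂⟩, hπ⟩ := h
  refine ⟨π₁, π₂, ?_⟩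
  rw [Equiv.Perm.sumCongrHom_apply] at hπ
  rw [hπ]
  ext i
  simp [Equiv.permCongr_apply]

/-- Every value `θ (e_J)` is an exterior product of `θ` with a fixed form. -/
theorem exists_topCoeff_wedge_eq_apply {n k r : ℕ} (h : k + r = 2 * n) (J : Fin r → Fin (2 * n)) :
    ∃ η : Alt n k, ∀ θ : Alt n r, topCoeff (wedge η θ) = θ fun i => realFrame n (J i) := by
  classical
  by_cases hJ : Function.Injective J
  swap
  -- A repeated index makes `θ (e_J)` vanish.
  · refine ⟨(0 : ℂ) • 0, fun θ => ?_⟩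
    rw [topCoeff_wedge_smul, zero_mul]
    simp only [Function.Injective, not_forall] at hJ
    obtain ⟨i, j, hij, hne⟩ := hJ
    exact (θ.map_eq_zero_of_eq _ (by simp only [hij]) hne).symm
  obtain ⟨ρ, hρ⟩ := exists_perm_natAdd_eq (k := k) (J := fun i => Fin.cast h.symm (J i))
    fun i j hij => hJ (Fin.cast_injective _ hij)
  let e : Fin (k + r) → Cn n := fun i => realFrame n (Fin.cast h i)
  -- Up to a scalar, `η` is the product of the coordinates complementary to `J`.
  let l : Fin k → Cn n →L[ℝ] ℂ := fun i => realCoord n (Fin.cast h (ρ (Fin.castAdd r i)))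
  have hle : ∀ i j, l i (e (ρ j)) = if Fin.castAdd r i = j then 1 else 0 := fun i j => by
    simp only [l, e, realCoord_realFrame, Fin.cast_inj, ρ.injective.eq_iff]
  let η : Alt n k := wedgeOneForms l
  have hη1 : η (fun i => e (ρ (Fin.castAdd r i))) = 1 := by
    simp only [η, wedgeOneForms_apply, hle]
    rw [Finset.sum_eq_single 1]
    · simp
    · intro π _ hπ
      obtain ⟨i, hi⟩ : ∃ i, π i ≠ i := by
        by_contra hcon
        push Not at hcon
        exact hπ (Equiv.ext hcon)
      rw [Finset.prod_eq_zero (Finset.mem_univ i), smul_zero]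
      rw [if_neg]
      exact fun hc => hi (Fin.castAdd_injective _ _ hc).symm
    · simp
  -- After reindexing by `ρ`, only the permutations preserving the first block contribute. For these
  -- the signs of the two block permutations cancel, so all the terms are equal.
  let good : Finset (Equiv.Perm (Fin (k + r))) := Finset.univ.filter fun κ =>
    ∀ i : Fin k, ∃ j : Fin k, κ (Fin.castAdd r i) = Fin.castAdd r j
  have hterm : ∀ (θ : Alt n r) (κ : Equiv.Perm (Fin (k + r))),
      Equiv.Perm.sign (ρ * κ) • (η (fun i => e ((ρ * κ) (Fin.castAdd r i))) *
        θ (fun i => e ((ρ * κ) (Fin.natAdd k i)))) =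
      if κ ∈ good then ((Equiv.Perm.sign ρ : ℤ) : ℂ) * θ (fun i => realFrame n (J i)) else 0 := by
    intro θ κ
    by_cases hκ : κ ∈ good
    · rw [if_pos hκ]
      obtain ⟨π₁, π₂, rfl⟩ := exists_sumCongr_of_castAdd (Finset.mem_filter.1 hκ).2
      have h1 : η (fun i => e ((ρ * finSumFinEquiv.permCongr (π₁.sumCongr π₂))
          (Fin.castAdd r i))) = Equiv.Perm.sign π₁ • 1 := by
        rw [← hη1, ← ContinuousAlternatingMap.coe_toAlternatingMap, ← AlternatingMap.map_perm]
        simp [Equiv.permCongr_apply, Function.comp_def]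
      have h2 : θ (fun i => e ((ρ * finSumFinEquiv.permCongr (π₁.sumCongr π₂))
          (Fin.natAdd k i))) = Equiv.Perm.sign π₂ • θ (fun i => realFrame n (J i)) := by
        rw [← ContinuousAlternatingMap.coe_toAlternatingMap, ← AlternatingMap.map_perm]
        simp [Equiv.permCongr_apply, Function.comp_def, hρ, e]
      rw [h1, h2, map_mul, Equiv.Perm.sign_permCongr, Equiv.Perm.sign_sumCongr]
      rcases Int.units_eq_one_or (Equiv.Perm.sign ρ) with a | a <;>
      rcases Int.units_eq_one_or (Equiv.Perm.sign π₁) with b | b <;>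
      rcases Int.units_eq_one_or (Equiv.Perm.sign π₂) with c | c <;>
      simp [a, b, c]
    · rw [if_neg hκ]
      have hex : ∃ i : Fin k, ∀ j : Fin k, κ (Fin.castAdd r i) ≠ Fin.castAdd r j := by
        simpa [good] using hκ
      obtain ⟨i, hi⟩ := hex
      have h0 : η (fun i => e ((ρ * κ) (Fin.castAdd r i))) = 0 := by
        simp only [η, wedgeOneForms_apply, Equiv.Perm.mul_apply, hle]
        refine Finset.sum_eq_zero fun π _ => ?_
        rw [Finset.prod_eq_zero (Finset.mem_univ (π.symm i)), smul_zero]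
        rw [if_neg]
        rw [Equiv.apply_symm_apply]
        exact fun hc => hi _ hc.symm
      rw [h0, zero_mul, smul_zero]
  have hcard : (good.card : ℂ) ≠ 0 := by
    refine Nat.cast_ne_zero.2 (Finset.card_ne_zero_of_mem (a := 1) ?_)
    simp [good]
  -- The number of good permutations need not be computed: it suffices that it is nonzero.
  set C : ℂ := (1 / ((k.factorial : ℂ) * (r.factorial : ℂ))) *
    (good.card * ((Equiv.Perm.sign ρ : ℤ) : ℂ)) with hC
  have hC0 : C ≠ 0 := by
    refine mul_ne_zero (one_div_ne_zero (mul_ne_zero ?_ ?_)) (mul_ne_zero hcard ?_)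
    · exact Nat.cast_ne_zero.2 (Nat.factorial_ne_zero _)
    · exact Nat.cast_ne_zero.2 (Nat.factorial_ne_zero _)
    · exact Int.cast_ne_zero.2 (Units.ne_zero _)
  refine ⟨C⁻¹ • η, fun θ => ?_⟩
  rw [topCoeff_wedge_smul, inv_mul_eq_iff_eq_mul₀ hC0, topCoeff_of_eq h, wedge_apply,
    ← Equiv.sum_comp (Equiv.mulLeft ρ)]
  simp only [Equiv.coe_mulLeft]
  rw [Finset.sum_congr rfl fun κ _ => hterm θ κ, Finset.sum_ite_mem, Finset.univ_inter,
    Finset.sum_const, nsmul_eq_mul, hC]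
  ring

/-- Smooth linear functionals of the coefficients of a form are exterior products with a smooth
form. -/
theorem exists_contDiff_topCoeff_wedge_eq {n k r : ℕ} (h : k + r = 2 * n)
    {b : (Fin r → Fin (2 * n)) → Cn n → ℂ} (hb : ∀ J, ContDiff ℝ ∞ (b J)) :
    ∃ B : Cn n → Alt n k, ContDiff ℝ ∞ B ∧ ∀ z (θ : Alt n r),
      topCoeff (wedge (B z) θ) = ∑ J, b J z * θ fun i => realFrame n (J i) := by
  choose η hη using fun J => exists_topCoeff_wedge_eq_apply h J
  refine ⟨fun z => ∑ J, b J z • η J, ContDiff.sum fun J _ => (hb J).smul contDiff_const,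
    fun z θ => ?_⟩
  simp only [topCoeff_wedge_sum, topCoeff_wedge_smul, hη]

/-! ### Quasianalytic sets -/

/-- The projection of `ℂᴹ⁺¹` onto its first `N` coordinates. -/
def firstCoords {N M : ℕ} (h : N ≤ M) : Cn (M + 1) →L[ℂ] Cn N :=
  ((PiLp.continuousLinearEquiv 2 ℂ fun _ : Fin N => ℂ).symm : (Fin N → ℂ) →L[ℂ] Cn N).comp
    (ContinuousLinearMap.pi fun i => EuclideanSpace.proj (Fin.castLE (h.trans (Nat.le_succ M)) i))

/-- A section of `firstCoords` with constant last coordinate. -/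
def extendCoords {N : ℕ} (M : ℕ) (a : ℂ) (t : Cn N) : Cn (M + 1) :=
  WithLp.toLp 2 fun i => if h : i.1 < N then t ⟨i.1, h⟩ else a

theorem firstCoords_extendCoords {N M : ℕ} (h : N ≤ M) (a : ℂ) (t : Cn N) :
    firstCoords h (extendCoords M a t) = t := by
  ext i
  simp [firstCoords, extendCoords]

theorem extendCoords_last {N M : ℕ} (h : N ≤ M) (a : ℂ) (t : Cn N) :
    extendCoords M a t (Fin.last M) = a := by
  simp [extendCoords, h]

theorem continuous_extendCoords {N : ℕ} (M : ℕ) (a : ℂ) :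
    Continuous (extendCoords M a : Cn N → Cn (M + 1)) := by
  refine (PiLp.continuous_toLp 2 _).comp (continuous_pi fun i => ?_)
  by_cases h : i.1 < N
  · simp only [h, dif_pos]
    fun_prop
  · simp only [h, dif_neg, not_false_iff]
    exact continuous_const

/-- The unit discs about the points `3l` are disjoint, so a coordinate confined to them can label
the pieces of a disjoint union. -/
theorem eq_of_norm_sub_lt {a : ℂ} {l m : ℕ} (hl : ‖a - 3 * l‖ < 1) (hm : ‖a - 3 * m‖ < 1) :
    l = m := by
  have h1 : ‖((3 * ((l : ℤ) - m) : ℤ) : ℂ)‖ < 2 := by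
    have : ((3 * ((l : ℤ) - m) : ℤ) : ℂ) = (a - 3 * m) - (a - 3 * l) := by push_cast; ring
    rw [this]
    exact (norm_sub_le _ _).trans_lt (by linarith)
  rw [Complex.norm_intCast] at h1
  have h2 : |3 * ((l : ℤ) - m)| < 2 := by exact_mod_cast h1
  rw [abs_lt] at h2
  omega

theorem finrank_range_le_of_forall_exists {E E' F : Type*} [NormedAddCommGroup E] [NormedSpace ℂ E]
    [NormedAddCommGroup E'] [NormedSpace ℂ E'] [NormedAddCommGroup F] [NormedSpace ℂ F]
    [FiniteDimensional ℂ F] {A : E →L[ℂ] F} {B : E' →L[ℂ] F} (h : ∀ v, ∃ w, B w = A v) :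
    Module.finrank ℂ (LinearMap.range A.toLinearMap) ≤
      Module.finrank ℂ (LinearMap.range B.toLinearMap) := by
  refine Submodule.finrank_mono ?_
  rintro _ ⟨v, rfl⟩
  exact h v

/-- The disjoint union of the `Ω l`, of different dimensions, is modelled by a single open subset of
`ℂᴹ⁺¹`: dummy coordinates are added, and the last coordinate, near `3l`, records the piece. The map
ignores these coordinates, so the image is unchanged and the rank does not increase. -/
theorem isCompactQuasianalytic_iUnion {n L : ℕ} {X : Type*} [TopologicalSpace X]
    [ChartedSpace (Cn n) X] {d : ℤ} {N : Fin L → ℕ} {g : ∀ l, Cn (N l) → X}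
    {Ω : ∀ l, Set (Cn (N l))} (hΩ : ∀ l, IsOpen (Ω l))
    (hg : ∀ l, ContMDiffOn 𝓘(ℂ, Cn (N l)) 𝓘(ℂ, Cn n) ω (g l) (Ω l)) {K : ∀ l, Set (Cn (N l))}
    (hK : ∀ l, IsCompact (K l)) (hKΩ : ∀ l, K l ⊆ Ω l)
    (hd : ∀ l, ∀ t ∈ K l, (Module.finrank ℂ (LinearMap.range
      (mfderiv 𝓘(ℂ, Cn (N l)) 𝓘(ℂ, Cn n) (g l) t : Cn (N l) →L[ℂ] Cn n).toLinearMap) : ℤ) ≤ d) :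
    IsCompactQuasianalytic n (⋃ l, g l '' K l) d := by
  let M := ∑ l, N l
  have hM : ∀ l, N l ≤ M := fun l => Finset.single_le_sum (fun _ _ => Nat.zero_le _)
    (Finset.mem_univ l)
  let B : Fin L → Set (Cn (M + 1)) := fun l => {z | ‖z (Fin.last M) - 3 * (l.1 : ℂ)‖ < 1}
  have hB : ∀ l, IsOpen (B l) := fun l => isOpen_lt (by fun_prop) continuous_const
  have hBΩ : ∀ l, IsOpen {z | z ∈ B l ∧ firstCoords (hM l) z ∈ Ω l} := fun l =>
    (hB l).inter ((hΩ l).preimage (firstCoords (hM l)).continuous)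
  let Y : TopologicalSpace.Opens (Cn (M + 1)) :=
    ⟨{z | ∃ l, z ∈ B l ∧ firstCoords (hM l) z ∈ Ω l}, by
      have : {z | ∃ l, z ∈ B l ∧ firstCoords (hM l) z ∈ Ω l} =
          ⋃ l, {z | z ∈ B l ∧ firstCoords (hM l) z ∈ Ω l} := by ext; simp
      rw [this]
      exact isOpen_iUnion hBΩ⟩
  -- The choice is forced, since the discs are disjoint. Hence `sel` is locally constant and `f` is
  -- locally some `g l` after a projection.
  let sel : Y → Fin L := fun y => y.2.choose
  have hsel : ∀ y : Y, y.1 ∈ B (sel y) ∧ firstCoords (hM (sel y)) y.1 ∈ Ω (sel y) :=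
    fun y => y.2.choose_spec
  have hsel_eq : ∀ (y : Y) l, y.1 ∈ B l → sel y = l := fun y l hl =>
    Fin.ext (eq_of_norm_sub_lt (hsel y).1 hl)
  let f : Y → X := fun y => g (sel y) (firstCoords (hM (sel y)) y.1)
  have hf_eq : ∀ (y : Y) l, y.1 ∈ B l → f y = g l (firstCoords (hM l) y.1) := fun y l hl => by
    obtain rfl := hsel_eq y l hl
    rfl
  have hf_near : ∀ y : Y,
      f =ᶠ[𝓝 y] fun x : Y => (g (sel y) ∘ firstCoords (hM (sel y))) x.1 := fun y => by
    have : {x : Y | x.1 ∈ B (sel y)} ∈ 𝓝 y :=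
      ((hB (sel y)).preimage continuous_subtype_val).mem_nhds (hsel y).1
    filter_upwards [this] with x hx using hf_eq x _ hx
  have hgat : ∀ y : Y, ContMDiffAt 𝓘(ℂ, Cn (N (sel y))) 𝓘(ℂ, Cn n) ω (g (sel y))
      (firstCoords (hM (sel y)) y.1) := fun y =>
    (hg (sel y)).contMDiffAt ((hΩ (sel y)).mem_nhds (hsel y).2)
  have hcomp : ∀ y : Y, ContMDiffAt 𝓘(ℂ, Cn (M + 1)) 𝓘(ℂ, Cn n) ω
      (g (sel y) ∘ firstCoords (hM (sel y))) y.1 := fun y =>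
    (hgat y).comp y.1 (firstCoords (hM (sel y))).contDiff.contMDiff.contMDiffAt
  let KY : Set Y := Subtype.val ⁻¹' ⋃ l : Fin L, extendCoords M (3 * (l.1 : ℂ)) '' K l
  have hmem : ∀ l, ∀ t ∈ K l, extendCoords M (3 * (l.1 : ℂ)) t ∈ B l ∧
      firstCoords (hM l) (extendCoords M (3 * (l.1 : ℂ)) t) ∈ Ω l := fun l t ht => by
    refine ⟨?_, ?_⟩
    · simp [B, extendCoords_last (hM l)]
    · rw [firstCoords_extendCoords]
      exact hKΩ l ht
  refine ⟨M + 1, Y, inferInstance, inferInstance, inferInstance, inferInstance, inferInstance, f,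
    KY, fun y => ?_, ?_, ?_, fun y hy => ?_⟩
  · exact (contMDiffAt_subtype_iff.2 (hcomp y)).congr_of_eventuallyEq (hf_near y)
  · refine (Topology.IsInducing.subtypeVal.isCompact_preimage_iff ?_).2
      (isCompact_iUnion fun l => (hK l).image (continuous_extendCoords M _))
    rw [Subtype.range_coe]
    refine Set.iUnion_subset fun l => ?_
    rintro _ ⟨t, ht, rfl⟩
    exact ⟨l, hmem l t ht⟩
  · ext x
    simp only [Set.mem_iUnion, Set.mem_image]
    constructor
    · rintro ⟨l, t, ht, rfl⟩
      refine ⟨⟨_, l, hmem l t ht⟩, Set.mem_iUnion.2 ⟨l, t, ht, rfl⟩, ?_⟩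
      rw [hf_eq _ l (hmem l t ht).1, firstCoords_extendCoords]
    · rintro ⟨y, hy, rfl⟩
      obtain ⟨l, t, ht, hty⟩ := Set.mem_iUnion.1 hy
      refine ⟨l, t, ht, ?_⟩
      rw [hf_eq y l (by rw [← hty]; exact (hmem l t ht).1), ← hty, firstCoords_extendCoords]
  · obtain ⟨l, t, ht, hty⟩ := Set.mem_iUnion.1 hy
    have hl : sel y = l := hsel_eq y l (by rw [← hty]; exact (hmem l t ht).1)
    have ht' : firstCoords (hM (sel y)) y.1 ∈ K (sel y) := by
      subst hl
      rw [← hty, firstCoords_extendCoords]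
      exact ht
    refine le_trans ?_ (hd (sel y) _ ht')
    have hval : MDifferentiableAt 𝓘(ℂ, Cn (M + 1)) 𝓘(ℂ, Cn (M + 1)) (Subtype.val : Y → _) y :=
      (contMDiff_subtype_val (n := ω) y).mdifferentiableAt (by simp)
    have h1 : mfderiv 𝓘(ℂ, Cn (M + 1)) 𝓘(ℂ, Cn n) f y = _ := (hf_near y).mfderiv_eq
    rw [h1]
    refine Nat.cast_le.2 (finrank_range_le_of_forall_exists (E := Cn (M + 1))
      (E' := Cn (N (sel y))) (F := Cn n) fun v => ?_)
    have h2 := mfderiv_comp_apply y ((hcomp y).mdifferentiableAt (by simp)) hval v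
    have h3 := mfderiv_comp_apply y.1 ((hgat y).mdifferentiableAt (by simp))
      (firstCoords (hM (sel y))).differentiableAt.mdifferentiableAt
      (mfderiv 𝓘(ℂ, Cn (M + 1)) 𝓘(ℂ, Cn (M + 1)) (Subtype.val : Y → _) y v)
    exact ⟨_, (h2.trans h3).symm⟩

/-! ### Holomorphic maps in charts -/

section Charts

variable {n N : ℕ} {X : Type*} [TopologicalSpace X] [ChartedSpace (Cn n) X]
  [IsManifold 𝓘(ℂ, Cn n) ω X]

theorem fderiv_chartAt_comp_apply {g : Cn N → X} {t : Cn N}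
    (hg : MDifferentiableAt 𝓘(ℂ, Cn N) 𝓘(ℂ, Cn n) g t) {p : X}
    (hp : g t ∈ (chartAt (Cn n) p).source) (v : Cn N) :
    fderiv ℂ (chartAt (Cn n) p ∘ g) t v =
      mfderiv 𝓘(ℂ, Cn n) 𝓘(ℂ, Cn n) (chartAt (Cn n) p) (g t)
        (mfderiv 𝓘(ℂ, Cn N) 𝓘(ℂ, Cn n) g t v) := by
  rw [← mfderiv_eq_fderiv]
  exact mfderiv_comp_apply t ((mdifferentiable_chart p).mdifferentiableAt hp) hg v

theorem surjective_fderiv_chartAt_comp {g : Cn N → X} {t : Cn N}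
    (hg : MDifferentiableAt 𝓘(ℂ, Cn N) 𝓘(ℂ, Cn n) g t) {p : X}
    (hp : g t ∈ (chartAt (Cn n) p).source) :
    Function.Surjective (fderiv ℂ (chartAt (Cn n) p ∘ g) t) ↔
      Function.Surjective (mfderiv 𝓘(ℂ, Cn N) 𝓘(ℂ, Cn n) g t) := by
  have hb := (mdifferentiable_chart (I := 𝓘(ℂ, Cn n)) p).mfderiv_bijective hp
  have : (fderiv ℂ (chartAt (Cn n) p ∘ g) t : Cn N → Cn n) =
      mfderiv 𝓘(ℂ, Cn n) 𝓘(ℂ, Cn n) (chartAt (Cn n) p) (g t) ∘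
        mfderiv 𝓘(ℂ, Cn N) 𝓘(ℂ, Cn n) g t :=
    funext (fderiv_chartAt_comp_apply hg hp)
  rw [this]
  exact Function.Surjective.of_comp_iff' hb _

theorem contDiffAt_chartAt_comp {g : Cn N → X} {t : Cn N}
    (hg : ContMDiffAt 𝓘(ℂ, Cn N) 𝓘(ℂ, Cn n) ω g t) {p : X}
    (hp : g t ∈ (chartAt (Cn n) p).source) : ContDiffAt ℂ ω (chartAt (Cn n) p ∘ g) t := by
  rw [← contMDiffAt_iff_contDiffAt]
  exact ((contMDiffOn_chart (I := 𝓘(ℂ, Cn n)) (n := ω) (x := p)).contMDiffAt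
    ((chartAt (Cn n) p).open_source.mem_nhds hp)).comp t hg

/-- If `S` is a right inverse of `A`, then `B ∘ S` is invertible for `B` near `A`, because units
form an open set; such a `B` is surjective. -/
theorem isOpen_setOf_surjective {E F : Type*} [NormedAddCommGroup E] [NormedSpace ℂ E]
    [NormedAddCommGroup F] [NormedSpace ℂ F] [FiniteDimensional ℂ F] :
    IsOpen {A : E →L[ℂ] F | Function.Surjective A} := by
  have : CompleteSpace F := FiniteDimensional.complete ℂ F
  rw [isOpen_iff_mem_nhds]
  intro A hA
  obtain ⟨S, hS⟩ := A.toLinearMap.exists_rightInverse_of_surjective (LinearMap.range_eq_top.2 hA)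
  let S' : F →L[ℂ] E := S.toContinuousLinearMap
  have hc : Continuous fun B : E →L[ℂ] F => B.comp S' := continuous_id.clm_comp continuous_const
  have h1 : IsUnit (A.comp S') := by
    have : A.comp S' = 1 := by
      ext v
      exact LinearMap.congr_fun hS v
    rw [this]
    exact isUnit_one
  filter_upwards [hc.continuousAt.preimage_mem_nhds
    ((Units.isOpen (R := F →L[ℂ] F)).mem_nhds h1)] with B hB
  obtain ⟨u, hu⟩ := hB
  intro y
  refine ⟨S' (u⁻¹.1 y), ?_⟩
  have h2 : (B.comp S') (u⁻¹.1 y) = y := by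
    rw [show B.comp S' = u from hu.symm]
    exact congrArg (fun T : F →L[ℂ] F => T y) u.mul_inv
  exact h2

theorem isOpen_surjective_mfderiv {g : Cn N → X} {Ω : Set (Cn N)} (hΩ : IsOpen Ω)
    (hg : ContMDiffOn 𝓘(ℂ, Cn N) 𝓘(ℂ, Cn n) ω g Ω) :
    IsOpen {t | t ∈ Ω ∧ Function.Surjective (mfderiv 𝓘(ℂ, Cn N) 𝓘(ℂ, Cn n) g t)} := by
  rw [isOpen_iff_mem_nhds]
  rintro t ⟨ht, hs⟩
  have hat : ∀ x ∈ Ω, ContMDiffAt 𝓘(ℂ, Cn N) 𝓘(ℂ, Cn n) ω g x := fun x hx =>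
    hg.contMDiffAt (hΩ.mem_nhds hx)
  have hsrc := mem_chart_source (Cn n) (g t)
  have hmd : ∀ x ∈ Ω, MDifferentiableAt 𝓘(ℂ, Cn N) 𝓘(ℂ, Cn n) g x := fun x hx =>
    (hat x hx).mdifferentiableAt (by simp)
  have hcont : ContinuousAt (fderiv ℂ (chartAt (Cn n) (g t) ∘ g)) t :=
    (contDiffAt_chartAt_comp (hat t ht) hsrc).continuousAt_fderiv (by simp)
  filter_upwards [hΩ.mem_nhds ht, (hat t ht).continuousAt.preimage_mem_nhds
    ((chartAt (Cn n) (g t)).open_source.mem_nhds hsrc), hcont.preimage_mem_nhds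
    (isOpen_setOf_surjective.mem_nhds ((surjective_fderiv_chartAt_comp (hmd t ht) hsrc).2 hs))]
    with x hx1 hx2 hx3
  exact ⟨hx1, (surjective_fderiv_chartAt_comp (hmd x hx1) hx2).1 hx3⟩

/-- Chain rule: the derivatives of the chart and of its inverse cancel. The pullback is thus
expressed through the coefficients of `ξ` in one fixed chart. -/
theorem pullback_eq_comp {r : ℕ} {g : Cn N → X} {t : Cn N}
    (hg : MDifferentiableAt 𝓘(ℂ, Cn N) 𝓘(ℂ, Cn n) g t) {p : X}
    (hp : g t ∈ (chartAt (Cn n) p).source) (ξ : X → Alt n r) :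
    pullback g ξ t = (pullback (chartAt (Cn n) p).symm ξ
      (chartAt (Cn n) p (g t))).compContinuousLinearMap
        ((fderiv ℂ (chartAt (Cn n) p ∘ g) t).restrictScalars ℝ) := by
  ext v
  simp only [pullback, ContinuousAlternatingMap.compContinuousLinearMap_apply]
  rw [(chartAt (Cn n) p).left_inv hp]
  refine congrArg (ξ (g t)) (funext fun i => ?_)
  have h := (mdifferentiable_chart (I := 𝓘(ℂ, Cn n)) p).symm_comp_deriv hp
  have h2 := congrArg (fun A : TangentSpace 𝓘(ℂ, Cn n) (g t) →L[ℂ] TangentSpace 𝓘(ℂ, Cn n) (g t) =>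
    A (mfderiv 𝓘(ℂ, Cn N) 𝓘(ℂ, Cn n) g t (v i))) h
  simp only [Function.comp_apply, ContinuousLinearMap.coe_restrictScalars']
  rw [fderiv_chartAt_comp_apply hg hp]
  exact h2.symm

/-- The expression in the chart at `p` of a form on `X`, extended by zero. -/
def chartForm {r : ℕ} (p : X) (ξ : X → Alt n r) : Cn n → Alt n r :=
  (chartAt (Cn n) p).target.indicator (pullback (chartAt (Cn n) p).symm ξ)

theorem chartForm_eq_zero {r : ℕ} {p : X} {ξ : X → Alt n r} {z : Cn n}
    (hz : z ∉ chartAt (Cn n) p '' tsupport ξ) : chartForm p ξ z = 0 := by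
  by_cases h : z ∈ (chartAt (Cn n) p).target
  · rw [chartForm, Set.indicator_of_mem h]
    have h0 : ξ ((chartAt (Cn n) p).symm z) = 0 := image_eq_zero_of_notMem_tsupport fun h' =>
      hz ⟨_, h', (chartAt (Cn n) p).right_inv h⟩
    rw [pullback, h0]
    rfl
  · exact Set.indicator_of_notMem h _

theorem isCompact_image_tsupport {r : ℕ} {p : X} (ξ : TestForm n X r)
    (hξ : tsupport ξ.1 ⊆ (chartAt (Cn n) p).source) :
    IsCompact (chartAt (Cn n) p '' tsupport ξ.1) :=
  ξ.2.1.isCompact.image_of_continuousOn ((chartAt (Cn n) p).continuousOn.mono hξ)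

theorem hasCompactSupport_chartForm {r : ℕ} {p : X} (ξ : TestForm n X r)
    (hξ : tsupport ξ.1 ⊆ (chartAt (Cn n) p).source) : HasCompactSupport (chartForm p ξ.1) :=
  HasCompactSupport.intro (isCompact_image_tsupport ξ hξ) fun _ hz => chartForm_eq_zero hz

theorem contDiff_chartForm {r : ℕ} {p : X} (ξ : TestForm n X r)
    (hξ : tsupport ξ.1 ⊆ (chartAt (Cn n) p).source) : ContDiff ℝ ∞ (chartForm p ξ.1) := by
  rw [contDiff_iff_contDiffAt]
  intro z
  by_cases hz : z ∈ (chartAt (Cn n) p).target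
  · have hnhds := (chartAt (Cn n) p).open_target.mem_nhds hz
    refine ((ξ.2.2 p).contDiffAt hnhds).congr_of_eventuallyEq ?_
    filter_upwards [hnhds] with w hw using Set.indicator_of_mem hw _
  -- The image of the support is compact, hence closed in `ℂⁿ`, so the extension by zero vanishes
  -- near every point outside the chart's target.
  · refine (contDiffAt_const (c := (0 : Alt n r))).congr_of_eventuallyEq ?_
    filter_upwards [(isCompact_image_tsupport ξ hξ).isClosed.isOpen_compl.mem_nhds
      (fun ⟨x, hx, hxz⟩ => hz (hxz ▸ (chartAt (Cn n) p).map_source (hξ hx)))] with w hw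
      using chartForm_eq_zero hw

end Charts

/-! ### Direct images of elementary currents -/

/-- The projection of `ℂᴺ` onto the coordinate subspace `{t_i = 0, i ∈ I}`. -/
def zeroOut {N : ℕ} (I : Finset (Fin N)) : Cn N →L[ℂ] Cn N :=
  ((PiLp.continuousLinearEquiv 2 ℂ fun _ : Fin N => ℂ).symm : (Fin N → ℂ) →L[ℂ] Cn N).comp
    (ContinuousLinearMap.pi fun i => if i ∈ I then 0 else EuclideanSpace.proj i)

theorem zeroOut_apply {N : ℕ} (I : Finset (Fin N)) (t : Cn N) (i : Fin N) :
    zeroOut I t i = if i ∈ I then 0 else t i := by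
  simp only [zeroOut, ContinuousLinearMap.comp_apply, ContinuousLinearEquiv.coe_coe,
    PiLp.continuousLinearEquiv_symm_apply, ContinuousLinearMap.pi_apply]
  split_ifs <;> rfl

theorem zeroOut_eq_self {N : ℕ} {I : Finset (Fin N)} {t : Cn N} (h : ∀ i ∈ I, t i = 0) :
    zeroOut I t = t := by
  ext i
  rw [zeroOut_apply]
  split_ifs with hi
  · exact (h i hi).symm
  · rfl

theorem coords_zeroOut {N : ℕ} (I : Finset (Fin N)) (t : Cn N) : coords I (zeroOut I t) = 0 := by
  funext i
  rw [coords_apply, zeroOut_apply, if_pos i.2]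
  rfl

theorem surjective_coords {N : ℕ} (I : Finset (Fin N)) : Function.Surjective (coords I) := by
  intro s
  refine ⟨WithLp.toLp 2 fun i => if h : i ∈ I then s ⟨i, h⟩ else 0, ?_⟩
  funext i
  rw [coords_apply]
  simp

/-- The coordinates in `I` are prescribed first; the value of `D` is then corrected by a vector of
the stratum, which leaves those coordinates unchanged. -/
theorem surjective_prod_coords {N n : ℕ} {I : Finset (Fin N)} {D : Cn N →L[ℝ] Cn n}
    (hD : Function.Surjective fun v => D (zeroOut I v)) :
    Function.Surjective (D.prod (coords I)) := by
  rintro ⟨x, s⟩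
  obtain ⟨v, hv⟩ := surjective_coords I s
  obtain ⟨w, hw⟩ := hD (x - D v)
  refine ⟨v + zeroOut I w, ?_⟩
  beta_reduce at hw
  ext1
  · simp [hw]
  · simp [coords_zeroOut, hv]

section Pushed

variable {n : ℕ} {X : Type*} [TopologicalSpace X] [ChartedSpace (Cn n) X]
  [IsManifold 𝓘(ℂ, Cn n) ω X]

/-- In a chart, a holomorphic map agrees near a given point with a globally defined smooth map. -/
theorem exists_contDiff_eq_chartAt_comp {N : ℕ} {g : Cn N → X} {Ω : Set (Cn N)} (hΩ : IsOpen Ω)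
    (hg : ContMDiffOn 𝓘(ℂ, Cn N) 𝓘(ℂ, Cn n) ω g Ω) {p : X} {t₀ : Cn N} (ht₀ : t₀ ∈ Ω)
    (hp : g t₀ ∈ (chartAt (Cn n) p).source) :
    ∃ f : Cn N → Cn n, ContDiff ℝ ∞ f ∧ ∃ W : Set (Cn N), IsOpen W ∧ t₀ ∈ W ∧ W ⊆ Ω ∧ ∀ t ∈ W,
      g t ∈ (chartAt (Cn n) p).source ∧ f t = chartAt (Cn n) p (g t) ∧
      fderiv ℝ f t = (fderiv ℂ (chartAt (Cn n) p ∘ g) t).restrictScalars ℝ := by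
  have hΩ' : IsOpen (Ω ∩ g ⁻¹' (chartAt (Cn n) p).source) :=
    hg.continuousOn.isOpen_inter_preimage hΩ (chartAt (Cn n) p).open_source
  obtain ⟨ε, hε, hball⟩ := Metric.isOpen_iff.1 hΩ' t₀ ⟨ht₀, hp⟩
  -- The cutoff is 1 on the ball of radius `ε / 4`, where the original map is retained, and its
  -- support stays where the chart expression is holomorphic.
  let χ : ContDiffBump t₀ := ⟨ε / 4, ε / 2, by positivity, by linarith⟩
  have hχ : tsupport χ ⊆ Ω ∩ g ⁻¹' (chartAt (Cn n) p).source := by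
    rw [χ.tsupport_eq]
    exact (Metric.closedBall_subset_ball (by simp only [χ]; linarith)).trans hball
  have hch : ∀ t ∈ Ω ∩ g ⁻¹' (chartAt (Cn n) p).source,
      ContDiffAt ℂ ω (chartAt (Cn n) p ∘ g) t := fun t ht =>
    contDiffAt_chartAt_comp (hg.contMDiffAt (hΩ.mem_nhds ht.1)) ht.2
  have hin : Metric.ball t₀ (ε / 4) ⊆ Ω ∩ g ⁻¹' (chartAt (Cn n) p).source :=
    (Metric.ball_subset_ball (by linarith)).trans hball
  have heq : ∀ t ∈ Metric.ball t₀ (ε / 4), χ t • (chartAt (Cn n) p ∘ g) t =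
      (chartAt (Cn n) p ∘ g) t := fun t ht => by
    rw [χ.one_of_mem_closedBall (Metric.ball_subset_closedBall ht), one_smul]
  refine ⟨fun t => χ t • (chartAt (Cn n) p ∘ g) t, ?_, Metric.ball t₀ (ε / 4), Metric.isOpen_ball,
    Metric.mem_ball_self (by positivity), hin.trans Set.inter_subset_left, fun t ht =>
      ⟨(hin ht).2, heq t ht, ?_⟩⟩
  · refine contDiff_of_tsupport fun t ht => ?_
    have ht' := hχ (tsupport_smul_subset_left _ _ ht)
    exact χ.contDiff.contDiffAt.smul (((hch t ht').restrict_scalars ℝ).of_le (by simp))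
  · have h1 : (fun t => χ t • (chartAt (Cn n) p ∘ g) t) =ᶠ[𝓝 t] chartAt (Cn n) p ∘ g := by
      filter_upwards [Metric.isOpen_ball.mem_nhds ht] with s hs using heq s hs
    rw [h1.fderiv_eq]
    exact (((hch t (hin ht)).differentiableAt (by simp)).hasFDerivAt.restrictScalars ℝ).fderiv

namespace PushedElementary

variable (P : PushedElementary n X)

/-- The factor of the integrand of an elementary current that does not depend on the test form. -/
def factor (t : Cn P.N) : Alt P.N (P.τ.deg + P.τ.res.card) := wedge (P.τ.α t) P.τ.dConjRes

theorem contDiff_factor (v) : ContDiff ℝ ∞ fun t => P.factor t v :=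
  contDiff_wedge_apply (fun w => by
    have h : ContDiff ℝ ∞ fun A : Alt P.N P.τ.deg => A w :=
      (ContinuousAlternatingMap.apply ℝ (Cn P.N) ℂ w).contDiff
    exact h.comp P.τ.smooth_α) _ v

theorem factor_eq_zero {t : Cn P.N} (ht : t ∉ tsupport P.τ.α) {r : ℕ} (η : Alt P.N r) :
    topCoeff (wedge (P.factor t) η) = 0 := by
  have h : P.factor t = (0 : ℂ) • P.factor t := by
    ext v
    rw [ContinuousAlternatingMap.smul_apply, zero_smul, factor, image_eq_zero_of_notMem_tsupport ht, wedge_apply]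
    simp
  rw [h, topCoeff_wedge_smul, zero_mul]

/-- The integrand of `f_* τ . ξ`, before differentiation. -/
def integrand {r : ℕ} (ξ : X → Alt n r) (t : Cn P.N) : ℂ :=
  topCoeff (wedge (P.factor t) (pullback P.f ξ t))

theorem eval_eq {r : ℕ} (ξ : TestForm n X r) : P.eval ξ = P.τ.scalarPart (P.integrand ξ.1) := rfl

/-- The restriction of `f` to every stratum of the polar hyperplanes of `τ` through `t` is
submersive at `t`. -/
def IsRegularAt (t : Cn P.N) : Prop :=
  ∀ I ⊆ P.τ.pv ∪ P.τ.res, (∀ i ∈ I, t i = 0) →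
    Function.Surjective (mfderiv 𝓘(ℂ, Cn P.N) 𝓘(ℂ, Cn n) (P.f ∘ zeroOut I) t)

/-- Only the smallest stratum through `t` is used, cut out by all polar hyperplanes containing `t`.
Since `zeroOut I` fixes `t`, the chain rule gives the derivative of `f` at `t` on vectors of the
stratum. -/
theorem surjective_fderiv_prod_coords {p : X} {t : Cn P.N} (htd : t ∈ P.τ.dom)
    (hp : P.f t ∈ (chartAt (Cn n) p).source) (ht : P.IsRegularAt t) :
    Function.Surjective (((fderiv ℂ (chartAt (Cn n) p ∘ P.f) t).restrictScalars ℝ).prod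
      (coords ((P.τ.pv ∪ P.τ.res).filter fun j => t j = 0))) := by
  set I := (P.τ.pv ∪ P.τ.res).filter fun j => t j = 0 with hI
  have h0 : ∀ i ∈ I, t i = 0 := fun i hi => (Finset.mem_filter.1 hi).2
  have ht0 : zeroOut I t = t := zeroOut_eq_self h0
  have hat : ContMDiffAt 𝓘(ℂ, Cn P.N) 𝓘(ℂ, Cn n) ω P.f (zeroOut I t) := by
    rw [ht0]
    exact P.holo.contMDiffAt (P.τ.isOpen_dom.mem_nhds htd)
  have hp' : P.f (zeroOut I t) ∈ (chartAt (Cn n) p).source := by rwa [ht0]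
  have hs := (surjective_fderiv_chartAt_comp (g := P.f ∘ zeroOut I) (p := p)
    ((hat.mdifferentiableAt (by simp)).comp t (zeroOut I).differentiableAt.mdifferentiableAt)
    hp').2 (ht I (Finset.filter_subset _ _) h0)
  have hcomp := fderiv_comp (𝕜 := ℂ) t
    ((contDiffAt_chartAt_comp hat hp').differentiableAt (by simp)) (zeroOut I).differentiableAt
  refine surjective_prod_coords fun x => ?_
  obtain ⟨v, hv⟩ := hs x
  refine ⟨v, ?_⟩
  have h2 := congrArg (fun A : Cn P.N →L[ℂ] Cn n => A v) hcomp
  simp only [ContinuousLinearMap.fderiv, ht0] at h2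
  exact h2.symm.trans hv

/-- A functional on test forms of degree `r` supported in the chart at `p` has smooth
coefficients. -/
def HasSmoothCoeffs {r : ℕ} (p : X) (T : TestForm n X r → ℂ) (U : Set X) : Prop :=
  ∃ b : (Fin r → Fin (2 * n)) → Cn n → ℂ, (∀ J, ContDiff ℝ ∞ (b J)) ∧
    ∀ ξ : TestForm n X r, tsupport ξ.1 ⊆ U →
      T ξ = ∑ J, ∫ z, b J z * chartForm p ξ.1 z fun i => realFrame n (J i)

theorem contDiff_chartForm_apply {r : ℕ} {p : X} (ξ : TestForm n X r)
    (hξ : tsupport ξ.1 ⊆ (chartAt (Cn n) p).source) (v : Fin r → Cn n) :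
    ContDiff ℝ ∞ fun z => chartForm p ξ.1 z v := by
  have h : ContDiff ℝ ∞ fun A : Alt n r => A v :=
      (ContinuousAlternatingMap.apply ℝ (Cn n) ℂ v).contDiff
  exact h.comp (contDiff_chartForm ξ hξ)

theorem hasCompactSupport_chartForm_apply {r : ℕ} {p : X} (ξ : TestForm n X r)
    (hξ : tsupport ξ.1 ⊆ (chartAt (Cn n) p).source) (v : Fin r → Cn n) :
    HasCompactSupport fun z => chartForm p ξ.1 z v :=
  (hasCompactSupport_chartForm ξ hξ).comp_left (g := fun A : Alt n r => A v) rfl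

/-- The integrand is a sum of terms `a_J · (ξ_J ∘ f)`, with `ξ_J` the coefficients of `ξ` in the
chart, and the scalar result applies to each. The smoothness recorded last is what later permits
splitting `scalarPart` along a partition of unity. -/
theorem exists_nhds_hasSmoothCoeffs {p : X} {t₀ : Cn P.N} (htd : t₀ ∈ P.τ.dom)
    (hp : P.f t₀ ∈ (chartAt (Cn n) p).source) (ht₀ : P.IsRegularAt t₀) :
    ∃ W : Set (Cn P.N), IsOpen W ∧ t₀ ∈ W ∧ ∀ χ : Cn P.N → ℂ, ContDiff ℝ ∞ χ →
      HasCompactSupport χ → tsupport χ ⊆ W → ∀ r : ℕ,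
        HasSmoothCoeffs p (fun ξ : TestForm n X r =>
          P.τ.scalarPart fun t => χ t * P.integrand ξ.1 t) (chartAt (Cn n) p).source ∧
        ∀ ξ : TestForm n X r, tsupport ξ.1 ⊆ (chartAt (Cn n) p).source →
          ContDiff ℝ ∞ fun t => χ t * P.integrand ξ.1 t := by
  obtain ⟨f, hf, W₁, hW₁, htW₁, hWd, hfW⟩ := exists_contDiff_eq_chartAt_comp P.τ.isOpen_dom P.holo
    htd hp
  have hA := P.surjective_fderiv_prod_coords htd hp ht₀
  rw [← (hfW t₀ htW₁).2.2] at hA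
  obtain ⟨W, hW, htW, hdens⟩ := P.τ.exists_nhds_hasSmoothDensity_scalarPart hf hA
  refine ⟨W ∩ W₁, hW.inter hW₁, ⟨htW, htW₁⟩, fun χ hχ hχc hχW r => ?_⟩
  let a : (Fin r → Fin (2 * n)) → Cn P.N → ℂ := fun J t =>
    χ t * pullbackCoeff (P.factor t) (fderiv ℝ f t) J
  have ha : ∀ J, ContDiff ℝ ∞ (a J) := fun J =>
    hχ.mul (contDiff_pullbackCoeff P.contDiff_factor (hf.fderiv_right (by simp)) J)
  have hac : ∀ J, HasCompactSupport (a J) := fun J => hχc.mul_right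
  have haW : ∀ J, tsupport (a J) ⊆ W := fun J =>
    tsupport_mul_subset_left.trans (hχW.trans Set.inter_subset_left)
  have hint : ∀ ξ : TestForm n X r, (fun t => χ t * P.integrand ξ.1 t) =
      fun t => ∑ J, a J t * chartForm p ξ.1 (f t) fun i => realFrame n (J i) := fun ξ => by
    funext t
    by_cases ht : t ∈ tsupport χ
    · obtain ⟨h1, h2, h3⟩ := hfW t (hχW ht).2
      have hmd : MDifferentiableAt 𝓘(ℂ, Cn P.N) 𝓘(ℂ, Cn n) P.f t :=
        (P.holo.contMDiffAt (P.τ.isOpen_dom.mem_nhds (hWd (hχW ht).2))).mdifferentiableAt (by simp)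
      have h4 : chartForm p ξ.1 (f t) = pullback (chartAt (Cn n) p).symm ξ.1 (f t) := by
        rw [h2]
        exact Set.indicator_of_mem ((chartAt (Cn n) p).map_source h1) _
      rw [integrand, pullback_eq_comp hmd h1, ← h3, ← h2, ← h4, topCoeff_wedge_comp,
        Finset.mul_sum]
      exact Finset.sum_congr rfl fun J _ => (mul_assoc _ _ _).symm
    · simp [a, image_eq_zero_of_notMem_tsupport ht]
  choose b hb hbT using fun J => hdens (a J) (ha J) (hac J) (haW J)
  have hsm : ∀ ξ : TestForm n X r, tsupport ξ.1 ⊆ (chartAt (Cn n) p).source → ∀ J,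
      ContDiff ℝ ∞ fun t => a J t * chartForm p ξ.1 (f t) fun i => realFrame n (J i) :=
    fun ξ hξ J => (ha J).mul ((contDiff_chartForm_apply ξ hξ _).comp hf)
  refine ⟨⟨b, hb, fun ξ hξ => ?_⟩, fun ξ hξ => ?_⟩
  · beta_reduce
    rw [hint ξ, P.τ.scalarPart_sum _ (fun J _ => hsm ξ hξ J) fun J _ => (hac J).mul_right]
    exact Finset.sum_congr rfl fun J _ => hbT J _ (contDiff_chartForm_apply ξ hξ _)
      (hasCompactSupport_chartForm_apply ξ hξ _)
  · rw [hint ξ]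
    exact ContDiff.sum fun J _ => hsm ξ hξ J

end PushedElementary
end Pushed

/-! ### Globalization along fibres, critical sets, and the theorem -/

section Pushed

variable {n : ℕ} {X : Type*} [TopologicalSpace X] [ChartedSpace (Cn n) X]
  [IsManifold 𝓘(ℂ, Cn n) ω X]

theorem integrable_mul_chartForm {r : ℕ} {p : X} {b : Cn n → ℂ} (hb : ContDiff ℝ ∞ b)
    (ξ : TestForm n X r) (hξ : tsupport ξ.1 ⊆ (chartAt (Cn n) p).source) (v : Fin r → Cn n) :
    Integrable fun z => b z * chartForm p ξ.1 z v :=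
  integrable_mul_of_hasCompactSupport hb.continuous
    (PushedElementary.contDiff_chartForm_apply ξ hξ v).continuous
    (PushedElementary.hasCompactSupport_chartForm_apply ξ hξ v)

namespace PushedElementary

theorem HasSmoothCoeffs.mono {r : ℕ} {p : X} {T : TestForm n X r → ℂ} {U U' : Set X}
    (h : HasSmoothCoeffs p T U) (hU : U' ⊆ U) : HasSmoothCoeffs p T U' := by
  obtain ⟨b, hb, hT⟩ := h
  exact ⟨b, hb, fun ξ hξ => hT ξ (hξ.trans hU)⟩

theorem HasSmoothCoeffs.congr {r : ℕ} {p : X} {S T : TestForm n X r → ℂ} {U : Set X}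
    (h : HasSmoothCoeffs p T U) (hST : ∀ ξ : TestForm n X r, tsupport ξ.1 ⊆ U → S ξ = T ξ) :
    HasSmoothCoeffs p S U := by
  obtain ⟨b, hb, hT⟩ := h
  exact ⟨b, hb, fun ξ hξ => (hST ξ hξ).trans (hT ξ hξ)⟩

theorem HasSmoothCoeffs.sum {r : ℕ} {p : X} {ι : Type*} [Fintype ι] {T : ι → TestForm n X r → ℂ}
    {U : Set X} (hU : U ⊆ (chartAt (Cn n) p).source) (h : ∀ i, HasSmoothCoeffs p (T i) U) :
    HasSmoothCoeffs p (fun ξ => ∑ i, T i ξ) U := by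
  choose b hb hT using h
  refine ⟨fun J z => ∑ i, b i J z, fun J => ContDiff.sum fun i _ => hb i J, fun ξ hξ => ?_⟩
  simp only [Finset.sum_mul]
  rw [Finset.sum_congr rfl fun i _ => hT i ξ hξ, Finset.sum_comm]
  exact Finset.sum_congr rfl fun J _ => (integral_finsetSum _ fun i _ =>
    integrable_mul_chartForm (hb i J) ξ (hξ.trans hU) _).symm

variable (P : PushedElementary n X)

theorem integrand_eq_zero {r : ℕ} {ξ : X → Alt n r} {t : Cn P.N} (h : ξ (P.f t) = 0) :
    P.integrand ξ t = 0 := by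
  have h0 : pullback P.f ξ t = 0 := by
    rw [pullback, h]
    rfl
  rw [integrand, h0, topCoeff]
  split_ifs
  · simp [wedge_apply]
  · rfl

theorem integrand_eq_zero_of_notMem_tsupport {r : ℕ} (ξ : X → Alt n r) {t : Cn P.N}
    (ht : t ∉ tsupport P.τ.α) : P.integrand ξ t = 0 :=
  P.factor_eq_zero ht _

/-- Near a point all of whose preimages in the support of `τ` are regular, the current `f_* τ` has
smooth coefficients. -/
theorem exists_nhds_hasSmoothCoeffs_eval [T2Space X] (p : X)
    (h : ∀ t ∈ tsupport P.τ.α, P.f t = p → P.IsRegularAt t) :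
    ∃ U : Set X, IsOpen U ∧ p ∈ U ∧ U ⊆ (chartAt (Cn n) p).source ∧
      ∀ r : ℕ, HasSmoothCoeffs p (P.eval (r := r)) U := by
  classical
  have hcont : ContinuousOn P.f (tsupport P.τ.α) := P.holo.continuousOn.mono P.τ.tsupport_α
  have hαc : IsCompact (tsupport P.τ.α) := P.τ.compact_α
  set S : Set (Cn P.N) := tsupport P.τ.α ∩ P.f ⁻¹' {p} with hS
  have hSc : IsCompact S := hαc.of_isClosed_subset
    (hcont.preimage_isClosed_of_isClosed (isClosed_tsupport _) isClosed_singleton)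
    Set.inter_subset_left
  have hloc := fun t : S => P.exists_nhds_hasSmoothCoeffs (p := p) (P.τ.tsupport_α t.2.1)
    (by rw [show P.f t = p from t.2.2]; exact mem_chart_source _ _) (h t t.2.1 t.2.2)
  choose W hWo htW hW using hloc
  -- The unit balls serve only to make the supports of the partition functions bounded, hence
  -- compact.
  obtain ⟨s, hs⟩ := hSc.elim_finite_subcover (fun t : S => W t ∩ Metric.ball t.1 1)
    (fun t => (hWo t).inter Metric.isOpen_ball)
    fun t ht => Set.mem_iUnion.2 ⟨⟨t, ht⟩, htW _, Metric.mem_ball_self one_pos⟩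
  obtain ⟨K, hK, hSK, hKs⟩ := exists_compact_between hSc
    (isOpen_biUnion fun t _ => (hWo t).inter Metric.isOpen_ball) hs
  obtain ⟨ρ, hρ⟩ := SmoothPartitionOfUnity.exists_isSubordinate 𝓘(ℝ, Cn P.N) hK.isClosed
    (fun t : s => W t ∩ Metric.ball t.1.1 1) (fun t => (hWo t).inter Metric.isOpen_ball) fun t ht => by
      obtain ⟨i, hi, hti⟩ := Set.mem_iUnion₂.1 (hKs ht)
      exact Set.mem_iUnion.2 ⟨⟨i, hi⟩, hti⟩
  let χ : s → Cn P.N → ℂ := fun i t => ((ρ i t : ℝ) : ℂ)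
  have hχ : ∀ i, ContDiff ℝ ∞ (χ i) := fun i =>
    Complex.ofRealCLM.contDiff.comp (ρ i).contMDiff.contDiff
  have hχs : ∀ i, tsupport (χ i) ⊆ W i ∩ Metric.ball i.1.1 1 := fun i => by
    have : tsupport (χ i) ⊆ tsupport (ρ i) := closure_mono fun t ht => by
      simpa [χ] using ht
    exact this.trans (hρ i)
  have hχc : ∀ i, HasCompactSupport (χ i) := fun i =>
    Metric.isCompact_of_isClosed_isBounded (isClosed_tsupport _)
      (Metric.isBounded_ball.subset ((hχs i).trans Set.inter_subset_right))
  have hχ1 : ∀ t ∈ K, ∑ i, χ i t = 1 := fun t ht => by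
    have h1 := ρ.sum_eq_one ht
    rw [finsum_eq_sum_of_fintype] at h1
    simp only [χ]
    rw [← Complex.ofReal_sum, h1, Complex.ofReal_one]
  -- This compact set misses `p`, because `interior K` contains the whole fibre over `p` in the
  -- support of `α`. For `ξ` supported off `Z`, the integrand vanishes outside `K`, where the
  -- partition need not sum to 1.
  set Z := P.f '' (tsupport P.τ.α \ interior K) with hZ
  have hZc : IsClosed Z := ((hαc.diff isOpen_interior).image_of_continuousOn
    (hcont.mono Set.sdiff_subset)).isClosed
  have hpZ : p ∉ Z := by
    rintro ⟨t, ⟨ht, htK⟩, rfl⟩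
    exact htK (hSK ⟨ht, rfl⟩)
  refine ⟨(chartAt (Cn n) p).source ∩ Zᶜ, (chartAt (Cn n) p).open_source.inter hZc.isOpen_compl,
    ⟨mem_chart_source _ _, hpZ⟩, Set.inter_subset_left, fun r => ?_⟩
  have hi := fun i : s => hW i.1 (χ i) (hχ i) (hχc i)
    ((hχs i).trans Set.inter_subset_left) r
  refine (HasSmoothCoeffs.sum Set.inter_subset_left fun i : s =>
    (hi i).1.mono Set.inter_subset_left).congr fun ξ hξ => ?_
  have hsum : P.integrand ξ.1 = fun t => ∑ i, χ i t * P.integrand ξ.1 t := by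
    funext t
    rw [← Finset.sum_mul]
    by_cases htα : t ∈ tsupport P.τ.α
    · by_cases htK : t ∈ interior K
      · rw [hχ1 t (interior_subset htK), one_mul]
      · have h0 : ξ.1 (P.f t) = 0 := image_eq_zero_of_notMem_tsupport fun h' =>
          (hξ h').2 ⟨t, ⟨htα, htK⟩, rfl⟩
        rw [P.integrand_eq_zero h0, mul_zero]
    · rw [P.integrand_eq_zero_of_notMem_tsupport _ htα, mul_zero]
  refine (P.eval_eq ξ).trans ((congrArg _ hsum).trans ?_)
  exact P.τ.scalarPart_sum _ (fun i _ => (hi i).2 ξ (hξ.trans Set.inter_subset_left))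
    fun i _ => (hχc i).mul_right

/-- The points of the stratum `{t_i = 0, i ∈ I}` in the support of `τ` at which the restriction of
`f` to the stratum is not submersive. -/
def criticalSet (I : Finset (Fin P.N)) : Set (Cn P.N) :=
  (tsupport P.τ.α ∩ {t | ∀ i ∈ I, t i = 0}) \
    {t | t ∈ zeroOut I ⁻¹' P.τ.dom ∧
      Function.Surjective (mfderiv 𝓘(ℂ, Cn P.N) 𝓘(ℂ, Cn n) (P.f ∘ zeroOut I) t)}

theorem contMDiffOn_comp_zeroOut (I : Finset (Fin P.N)) :
    ContMDiffOn 𝓘(ℂ, Cn P.N) 𝓘(ℂ, Cn n) ω (P.f ∘ zeroOut I) (zeroOut I ⁻¹' P.τ.dom) :=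
  P.holo.comp (zeroOut I).contDiff.contMDiff.contMDiffOn subset_rfl

/-- Submersivity is an open condition, so a compact piece of the stratum loses only an open set. -/
theorem isCompact_criticalSet (I : Finset (Fin P.N)) : IsCompact (P.criticalSet I) := by
  refine (IsCompact.inter_right P.τ.compact_α ?_).diff (isOpen_surjective_mfderiv
    (P.τ.isOpen_dom.preimage (zeroOut I).continuous) (P.contMDiffOn_comp_zeroOut I))
  simp only [Set.ofPred_forall]
  exact isClosed_biInter fun i _ => isClosed_eq (by fun_prop) continuous_const

theorem criticalSet_subset (I : Finset (Fin P.N)) :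
    P.criticalSet I ⊆ zeroOut I ⁻¹' P.τ.dom := fun t ht => by
  rw [Set.mem_preimage, zeroOut_eq_self ht.1.2]
  exact P.τ.tsupport_α ht.1.1

theorem finrank_range_le_of_mem_criticalSet {I : Finset (Fin P.N)} {t : Cn P.N}
    (ht : t ∈ P.criticalSet I) : (Module.finrank ℂ (LinearMap.range
      (mfderiv 𝓘(ℂ, Cn P.N) 𝓘(ℂ, Cn n) (P.f ∘ zeroOut I) t :
        Cn P.N →L[ℂ] Cn n).toLinearMap) : ℤ) ≤ (n : ℤ) - 1 := by
  have hns : ¬ Function.Surjective (mfderiv 𝓘(ℂ, Cn P.N) 𝓘(ℂ, Cn n) (P.f ∘ zeroOut I) t) :=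
    fun hs => ht.2 ⟨P.criticalSet_subset I ht, hs⟩
  have h : LinearMap.range (mfderiv 𝓘(ℂ, Cn P.N) 𝓘(ℂ, Cn n) (P.f ∘ zeroOut I) t :
      Cn P.N →L[ℂ] Cn n).toLinearMap ≠ ⊤ := fun h => hns (LinearMap.range_eq_top.1 h)
  have h2 := Submodule.finrank_lt (K := ℂ) (V := Cn n) h
  rw [finrank_euclideanSpace_fin] at h2
  exact Int.le_sub_one_of_lt (Nat.cast_lt.2 h2)

theorem isRegularAt_of_notMem {p : X}
    (hp : ∀ I ⊆ P.τ.pv ∪ P.τ.res, p ∉ (P.f ∘ zeroOut I) '' P.criticalSet I) {t : Cn P.N}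
    (ht : t ∈ tsupport P.τ.α) (htp : P.f t = p) : P.IsRegularAt t := by
  intro I hI h0
  by_contra hns
  refine hp I hI ⟨t, ⟨⟨ht, h0⟩, fun h => hns h.2⟩, ?_⟩
  rw [Function.comp_apply, zeroOut_eq_self h0, htp]

end PushedElementary

open PushedElementary

/-- Each coefficient functional is a wedge product with a smooth form of complementary degree, by
`exists_contDiff_topCoeff_wedge_eq`. -/
theorem Current.smoothOn_of_hasSmoothCoeffs {μ : Current n X} {V : Set X}
    (h : ∀ p ∈ V, ∃ U : Set X, IsOpen U ∧ p ∈ U ∧ U ⊆ V ∩ (chartAt (Cn n) p).source ∧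
      ∀ r : ℕ, HasSmoothCoeffs p (μ.toFun r) U) : μ.SmoothOn V := by
  intro p hp
  obtain ⟨U, hU, hpU, hUV, hT⟩ := h p hp
  have hB : ∀ k r : ℕ, ∃ B : Cn n → Alt n k, ContDiff ℝ ∞ B ∧ (k + r = 2 * n →
      ∀ ξ : TestForm n X r, tsupport ξ.1 ⊆ U → μ.toFun r ξ =
        ∫ z in (chartAt (Cn n) p).target,
          topCoeff (wedge (B z) (pullback (chartAt (Cn n) p).symm ξ.1 z))) := by
    intro k r
    by_cases hkr : k + r = 2 * n
    swap
    · exact ⟨fun _ => 0, contDiff_const, fun h => absurd h hkr⟩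
    obtain ⟨b, hb, hbT⟩ := hT r
    obtain ⟨B, hBs, hB⟩ := exists_contDiff_topCoeff_wedge_eq hkr hb
    refine ⟨B, hBs, fun _ ξ hξ => ?_⟩
    have hξ' := hξ.trans (hUV.trans Set.inter_subset_right)
    rw [hbT ξ hξ, ← integral_finsetSum _ fun J _ => integrable_mul_chartForm (hb J) ξ hξ' _,
      ← setIntegral_eq_integral_of_forall_compl_eq_zero (s := (chartAt (Cn n) p).target)]
    · refine setIntegral_congr_fun (chartAt (Cn n) p).open_target.measurableSet fun z hz => ?_
      beta_reduce
      rw [hB, chartForm, Set.indicator_of_mem hz]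
    · intro z hz
      simp [chartForm, Set.indicator_of_notMem hz]
  choose B hBs hB using hB
  -- The subtraction is truncated, but for `k > 2n` no `r` satisfies `k + r = 2n`, so that component
  -- is never tested.
  refine ⟨U, hU, hpU, hUV, fun k => B k (2 * n - k), fun k => (hBs _ _).contDiffOn,
    fun k r hkr ξ hξ => ?_⟩
  obtain rfl : r = 2 * n - k := by omega
  exact hB _ _ hkr ξ hξ

theorem Current.hasSmoothCoeffs_of_notMem_support {μ : Current n X} {p : X} (hp : p ∉ μ.support) :
    ∃ U : Set X, IsOpen U ∧ p ∈ U ∧ U ⊆ (chartAt (Cn n) p).source ∧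
      ∀ r : ℕ, HasSmoothCoeffs p (μ.toFun r) U := by
  have hp' : ∃ U : Set X, IsOpen U ∧ p ∈ U ∧
      ∀ (r : ℕ) (ξ : TestForm n X r), tsupport ξ.1 ⊆ U → μ.toFun r ξ = 0 := by
    by_contra hcon
    push Not at hcon
    exact hp hcon
  obtain ⟨U, hU, hpU, h0⟩ := hp'
  refine ⟨U ∩ (chartAt (Cn n) p).source, hU.inter (chartAt (Cn n) p).open_source,
    ⟨hpU, mem_chart_source _ _⟩, Set.inter_subset_right, fun r => ⟨fun _ _ => 0,
      fun _ => contDiff_const, fun ξ hξ => ?_⟩⟩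
  simp [h0 r ξ (hξ.trans Set.inter_subset_left)]

theorem IsCompactQuasianalytic.isCompact {V : Set X} {d : ℤ} (h : IsCompactQuasianalytic n V d) :
    IsCompact V := by
  obtain ⟨m, Y, _, _, _, _, _, f, K, hf, hK, rfl, -⟩ := h
  exact hK.image hf.continuous

theorem Current.exists_isCompactQuasianalytic_smoothOn_compl [T2Space X] (μ : Current n X)
    (hμ : μ.IsPseudomeromorphic) (hc : IsCompact μ.support) :
    ∃ V : Set X, IsCompactQuasianalytic n V ((n : ℤ) - 1) ∧ μ.SmoothOn Vᶜ := by
  choose U hU hxU s P hP using hμ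
  obtain ⟨T, -, hT⟩ := hc.elim_nhds_subcover U fun x _ => (hU x).mem_nhds (hxU x)
  -- All index sets are admitted, not only polar ones. This may enlarge `V`, but the rank bound
  -- holds for every coordinate stratum.
  let ι := Σ x : T, Σ l : Fin (s x), Finset (Fin (P x l).N)
  let e : ι ≃ Fin (Fintype.card ι) := Fintype.equivFin ι
  let Q : ι → PushedElementary n X := fun i => P i.1 i.2.1
  let V : Set X := ⋃ j : Fin (Fintype.card ι),
    ((Q (e.symm j)).f ∘ zeroOut (e.symm j).2.2) '' (Q (e.symm j)).criticalSet (e.symm j).2.2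
  have hV : IsCompactQuasianalytic n V ((n : ℤ) - 1) := isCompactQuasianalytic_iUnion
    (fun j => (Q (e.symm j)).τ.isOpen_dom.preimage (zeroOut (e.symm j).2.2).continuous)
    (fun j => (Q (e.symm j)).contMDiffOn_comp_zeroOut _)
    (fun j => (Q (e.symm j)).isCompact_criticalSet _)
    (fun j => (Q (e.symm j)).criticalSet_subset _)
    (fun j t ht => (Q (e.symm j)).finrank_range_le_of_mem_criticalSet ht)
  have hVo : IsOpen Vᶜ := hV.isCompact.isClosed.isOpen_compl
  refine ⟨V, hV, Current.smoothOn_of_hasSmoothCoeffs fun p hp => ?_⟩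
  suffices h : ∃ U : Set X, IsOpen U ∧ p ∈ U ∧ U ⊆ (chartAt (Cn n) p).source ∧
      ∀ r : ℕ, HasSmoothCoeffs p (μ.toFun r) U by
    obtain ⟨U, hU, hpU, hUs, h⟩ := h
    exact ⟨Vᶜ ∩ U, hVo.inter hU, ⟨hp, hpU⟩, Set.inter_subset_inter_right _ hUs,
      fun r => (h r).mono Set.inter_subset_right⟩
  by_cases hps : p ∈ μ.support
  swap
  · exact Current.hasSmoothCoeffs_of_notMem_support hps
  obtain ⟨x, hxT, hpx⟩ := Set.mem_iUnion₂.1 (hT hps)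
  -- A preimage of `p` that is not regular would lie in some critical set, which would put `p` in
  -- `V`.
  have hreg : ∀ l, ∀ t ∈ tsupport (P x l).τ.α, (P x l).f t = p → (P x l).IsRegularAt t :=
    fun l t ht htp => (P x l).isRegularAt_of_notMem (fun I _ hI => hp (by
      refine Set.mem_iUnion.2 ⟨e ⟨⟨x, hxT⟩, l, I⟩, ?_⟩
      rw [e.symm_apply_apply]
      exact hI)) ht htp
  choose O hO hpO hOs hOT using fun l => (P x l).exists_nhds_hasSmoothCoeffs_eval p (hreg l)
  refine ⟨(U x ∩ (chartAt (Cn n) p).source) ∩ ⋂ l, O l,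
    ((hU x).inter (chartAt (Cn n) p).open_source).inter (isOpen_iInter_of_finite hO),
    ⟨⟨hpx, mem_chart_source _ _⟩, Set.mem_iInter.2 hpO⟩, fun y hy => hy.1.2, fun r => ?_⟩
  exact (HasSmoothCoeffs.sum (fun y hy => hy.1.2) fun l => (hOT l r).mono fun y hy =>
    Set.mem_iInter.1 hy.2 l).congr fun ξ hξ => hP x r ξ fun y hy => (hξ hy).1.1

end Pushed

end PMCurrents

end

theorem theorem3p10 {n : ℕ} {X : Type*} [TopologicalSpace X] [T2Space X]
    [ChartedSpace (PMCurrents.Cn n) X] [IsManifold 𝓘(ℂ, PMCurrents.Cn n) ω X]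
    (μ : PMCurrents.Current n X) (hμ : μ.IsPseudomeromorphic) (hc : IsCompact μ.support) :
    ∃ V : Set X, PMCurrents.IsCompactQuasianalytic n V ((n : ℤ) - 1) ∧ μ.SmoothOn Vᶜ :=
  μ.exists_isCompactQuasianalytic_smoothOn_compl hμ hc
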